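/- A finite simple signed graph is a triple $G=(V,E,\sigma)$ where $(V,E)$ is a finite simple graph and $\sigma:E\to\{-1,1\}$. The sign of a cycle $C$ of $G$ is $\sigma(C)=\prod_{e\in E(C)}\sigma(e)$, and $C$ is called positive if $\sigma(C)=1$ and negative if $\sigma(C)=-1$. $G$ is 3-connected if $|V|\ge 4$ and deleting any set of at most two vertices leaves a connected graph. Let $G=(V,E,\sigma)$ be a finite simple 3-connected signed graph and let $e_1,e_2\in E$ be nonadjacent edges, i.e. edges with no common end. If the signed graph $G-\{e_1,e_2\}$, obtained by deleting the edges $e_1,e_2$, contains a negative cycle, then $e_1$ and $e_2$ are untied in $G$: there exist a positive cycle of $G$ containing both $e_1$ and $e_2$ and a negative cycle of $G$ containing both $e_1$ and $e_2$. -/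

import Mathlib

/-- A finite simple signed graph `(V, E, σ)`: a simple graph together with a signature
`σ : E → {-1, 1}` (finiteness of `V` is required where the structure is used). -/
structure SimpleSignedGraph (V : Type*) where
  graph : SimpleGraph V
  sign : graph.edgeSet → ℤˣ

namespace SimpleSignedGraph

variable {V : Type*}

/-- `G - F`: delete the edges in `F` and restrict the signature to the remaining edges. -/
def deleteEdges (G : SimpleSignedGraph V) (F : Set (Sym2 V)) : SimpleSignedGraph V where
  graph := G.graph.deleteEdges F
  sign e := G.sign ⟨e.1, SimpleGraph.edgeSet_mono (SimpleGraph.deleteEdges_le F) e.2⟩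

/-- The product of the signs of the edges traversed by a walk. A cycle traverses each of its
edges once, so for a cycle `C` this is the product of `σ e` over `e ∈ E(C)`. -/
def walkSign (G : SimpleSignedGraph V) {u v : V} (p : G.graph.Walk u v) : ℤˣ :=
  (p.edges.attach.map fun e => G.sign ⟨e.1, p.edges_subset_edgeSet e.2⟩).prod

/-- There is a negative cycle. -/
def Unbalanced (G : SimpleSignedGraph V) : Prop :=
  ∃ (v : V) (C : G.graph.Walk v v), C.IsCycle ∧ G.walkSign C = -1

/-- There are cycles of both signs that contain both `e₁` and `e₂`. -/
def Untied (G : SimpleSignedGraph V) (e₁ e₂ : Sym2 V) : Prop :=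
  ∀ s : ℤˣ, ∃ (v : V) (C : G.graph.Walk v v),
    C.IsCycle ∧ e₁ ∈ C.edges ∧ e₂ ∈ C.edges ∧ G.walkSign C = s

end SimpleSignedGraph

/-- `k`-connectedness of a (finite) graph: more than `k` vertices, and deleting fewer than `k`
vertices always leaves a connected graph. -/
def SimpleGraph.IsVertexConnected {V : Type*} (G : SimpleGraph V) (k : ℕ) : Prop :=
  k < Nat.card V ∧ ∀ S : Finset V, S.card < k → (G.induce ((S : Set V)ᶜ)).Connected

/-! Signs become labels in `ZMod 2`. Two disjoint paths joining the ends of e₁ to those of e₂ close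
up through e₁ and e₂ to a cycle (`Linkage.exists_isCycle`), so it suffices to find such linkages of
both parities.

Let C be an odd cycle avoiding e₁ and e₂. By 3-connectivity some linkage P, Q meets C in at least
two vertices (`OddCycleOn.linkageMeetsTwice`): any linkage is joined to C by two disjoint tails, and
while C is not met twice the linkage is rerouted along a further path, which shortens a tail or
leads a linking path through C.

Take partial sums of labels along P and along Q as a potential. Since C is odd, one of its arcs is
inconsistent with the potential, hence so is some ear of P ∪ Q inside that arc. If the ear has both
ends on one linking path, rerouting through it changes the parity. Otherwise it is a rung between P
and Q. Shifting the potential by 1 on Q makes the complementary arc inconsistent and yields a second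
rung; the two rungs with the segments of P and Q between their ends have odd total label
(`OddCycleOn.bothParities_of_linkage`).

It remains to treat two such rungs (`bothParities_of_rungs`). If they cross, switching sides along
both gives the other parity. If they are disjoint and parallel, the pieces of the configuration on
the sides of e₁ and e₂ are hubs: pieces with a potential that governs the labels of all pairs of
exits using a frontier vertex. 3-connectivity gives a further path out of the first hub; either it
produces both parities, or it is consistent with the potential and the hub absorbs it and moves
closer to the second hub (`Hub.bothParities`). Rungs with one common end need a weaker starting
piece, in which parities are not tracked until a hub can be built
(`bothParities_of_adjacent_rungs_aux`). Rungs with both ends in common are reduced to that case by a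
path leaving the interior of a rung. The rungs avoid e₁ and e₂, so each hub has an exit off its
frontier. -/

/-! ### Labelled paths, recorded by vertex set and label sum -/

namespace SimpleGraph

variable {V : Type*}

/-- There is a path of `G` from `x` to `y` with vertex set `U` whose edge labels sum up to `s`. -/
def PathOn (G : SimpleGraph V) (σ : Sym2 V → ZMod 2) (U : Set V) (s : ZMod 2) (x y : V) : Prop :=
  ∃ p : G.Walk x y, p.IsPath ∧ (∀ v, v ∈ p.support ↔ v ∈ U) ∧ (p.edges.map σ).sum = s

namespace PathOn

variable {G : SimpleGraph V} {σ : Sym2 V → ZMod 2} {U W : Set V} {s t : ZMod 2} {x y z : V}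

theorem left_mem (h : G.PathOn σ U s x y) : x ∈ U := by
  obtain ⟨p, -, hU, -⟩ := h
  exact (hU x).1 p.start_mem_support

theorem right_mem (h : G.PathOn σ U s x y) : y ∈ U := by
  obtain ⟨p, -, hU, -⟩ := h
  exact (hU y).1 p.end_mem_support

attribute [grind] left_mem right_mem

theorem refl (G : SimpleGraph V) (σ : Sym2 V → ZMod 2) (x : V) : G.PathOn σ {x} 0 x x :=
  ⟨.nil, .nil, by simp, by simp⟩

theorem of_adj (σ : Sym2 V → ZMod 2) (h : G.Adj x y) : G.PathOn σ {x, y} (σ s(x, y)) x y :=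
  ⟨h.toWalk, by simp [h.ne], by simp, by simp⟩

theorem symm (h : G.PathOn σ U s x y) : G.PathOn σ U s y x := by
  obtain ⟨p, hp, hU, hs⟩ := h
  exact ⟨p.reverse, hp.reverse, by simpa using hU, by simpa [List.sum_reverse] using hs⟩

theorem mono {H : SimpleGraph V} (hle : H ≤ G) (h : H.PathOn σ U s x y) : G.PathOn σ U s x y := by
  obtain ⟨p, hp, hU, hs⟩ := h
  exact ⟨p.mapLe hle, hp.mapLe hle, by simpa using hU, by simpa using hs⟩

theorem append (h : G.PathOn σ U s x y) (h' : G.PathOn σ W t y z)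
    (hUW : ∀ v, v ∈ U → v ∈ W → v = y) : G.PathOn σ (U ∪ W) (s + t) x z := by
  obtain ⟨p, hp, hU, hs⟩ := h
  obtain ⟨q, hq, hW, ht⟩ := h'
  refine ⟨p.append q, ?_, by simp [Walk.mem_support_append_iff, hU, hW], by simp [hs, ht]⟩
  rw [Walk.isPath_def, Walk.support_append, List.nodup_append']
  refine ⟨hp.support_nodup, hq.support_nodup.tail, fun v hv hv' => ?_⟩
  have := hUW v ((hU v).1 hv) ((hW v).1 (List.mem_of_mem_tail hv'))
  subst this
  have h1 := hq.support_nodup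
  rw [← Walk.cons_tail_support] at h1
  exact (List.nodup_cons.1 h1).1 hv'

theorem split (h : G.PathOn σ U s x y) {m : V} (hm : m ∈ U) :
    ∃ U₁ U₂ s₁ s₂, G.PathOn σ U₁ s₁ x m ∧ G.PathOn σ U₂ s₂ m y ∧
      (∀ v, v ∈ U₁ → v ∈ U) ∧ (∀ v, v ∈ U₂ → v ∈ U) ∧ (∀ v, v ∈ U → v ∈ U₁ ∨ v ∈ U₂) ∧
      (∀ v, v ∈ U₁ → v ∈ U₂ → v = m) ∧ s = s₁ + s₂ := by
  classical
  obtain ⟨p, hp, hU, hs⟩ := h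
  have hm' := (hU m).2 hm
  have hspec := p.take_spec hm'
  have key : ∀ v, v ∈ U ↔ v ∈ (p.takeUntil m hm').support ∨ v ∈ (p.dropUntil m hm').support :=
    fun v => by rw [← hU, ← Walk.mem_support_append_iff, hspec]
  refine ⟨{v | v ∈ (p.takeUntil m hm').support}, {v | v ∈ (p.dropUntil m hm').support}, _, _,
    ⟨_, hp.takeUntil hm', fun v => Iff.rfl, rfl⟩, ⟨_, hp.dropUntil hm', fun v => Iff.rfl, rfl⟩,
    fun v h => (key v).2 (.inl h), fun v h => (key v).2 (.inr h), fun v => (key v).1,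
    fun v h1 h2 => ?_, ?_⟩
  · have h3 := hp.support_nodup
    rw [← hspec, Walk.support_append, List.nodup_append'] at h3
    by_contra hne
    refine h3.2.2 h1 ?_
    have h2' : v ∈ (p.dropUntil m hm').support := h2
    rw [← Walk.cons_tail_support, List.mem_cons] at h2'
    exact h2'.resolve_left hne
  · rw [← hs, ← List.sum_append, ← List.map_append, ← Walk.edges_append, hspec]

theorem eq_zero_of_loop (h : G.PathOn σ U s x x) : (∀ v, v ∈ U ↔ v = x) ∧ s = 0 := by
  obtain ⟨p, hp, hU, hs⟩ := h
  obtain rfl := (Walk.isPath_iff_nil.1 hp).eq_nil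
  exact ⟨fun v => by rw [← hU]; simp, by simpa using hs.symm⟩

/-- Used to recognise a rung without inner vertices as a single edge, whose label is then
determined. -/
theorem adj_of_subset_pair (h : G.PathOn σ U s x y) (hxy : x ≠ y)
    (hU : ∀ v, v ∈ U → v = x ∨ v = y) : G.Adj x y ∧ s = σ s(x, y) := by
  obtain ⟨p, hp, hp', hs⟩ := h
  cases p with
  | nil => exact absurd rfl hxy
  | @cons _ w _ hadj q =>
    have h1 : w ∈ U := (hp' w).1 (by simp)
    rcases hU w h1 with rfl | rfl
    · exact absurd hadj (G.irrefl)
    · rw [Walk.cons_isPath_iff] at hp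
      obtain rfl := (Walk.isPath_iff_nil.1 hp.1).eq_nil
      exact ⟨hadj, by simpa using hs.symm⟩

theorem ncard_lt_of_split [Finite V] {U₁ : Set V} {m : V}
    (hU : ∀ v, v ∈ U₁ → v ∈ U) (hm : m ∈ U) (hm' : m ∉ U₁) : U₁.ncard < U.ncard :=
  Set.ncard_lt_ncard ⟨hU, fun h => hm' (h hm)⟩ (Set.toFinite _)

/-- A path from a vertex of `X` to a vertex of `Y` contains a path from `X` to `Y` that meets
`X` and `Y` only in its ends. -/
theorem trim [Finite V] (h : G.PathOn σ U s x y) {X Y : Set V} (hx : x ∈ X) (hy : y ∈ Y) :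
    ∃ U' s' x' y', G.PathOn σ U' s' x' y' ∧ (∀ v, v ∈ U' → v ∈ U) ∧ x' ∈ X ∧ y' ∈ Y ∧
      (∀ v, v ∈ U' → v ∈ X → v = x') ∧ (∀ v, v ∈ U' → v ∈ Y → v = y') := by
  induction hn : U.ncard using Nat.strong_induction_on generalizing U s x y with
  | _ n ih =>
    -- Restarting at a further vertex of `X` drops `x` from the path, so the vertex set shrinks;
    -- symmetrically for `Y`.
    by_cases h1 : ∃ v, v ∈ U ∧ v ∈ X ∧ v ≠ x
    · obtain ⟨v, hvU, hvX, hne⟩ := h1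
      obtain ⟨U₁, U₂, s₁, s₂, p₁, p₂, hU₁, hU₂, -, hd, -⟩ := h.split hvU
      have hlt : U₂.ncard < U.ncard := ncard_lt_of_split hU₂ h.left_mem
        (fun hx' => hne (hd x p₁.left_mem hx').symm)
      obtain ⟨U', s', x', y', q, hsub, rest⟩ := ih _ (hn ▸ hlt) p₂ hvX hy rfl
      exact ⟨U', s', x', y', q, fun w hw => hU₂ w (hsub w hw), rest⟩
    by_cases h2 : ∃ v, v ∈ U ∧ v ∈ Y ∧ v ≠ y
    · obtain ⟨v, hvU, hvY, hne⟩ := h2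
      obtain ⟨U₁, U₂, s₁, s₂, p₁, p₂, hU₁, hU₂, -, hd, -⟩ := h.split hvU
      have hlt : U₁.ncard < U.ncard := ncard_lt_of_split hU₁
        h.right_mem (fun hy' => hne (hd y hy' p₂.right_mem).symm)
      obtain ⟨U', s', x', y', q, hsub, rest⟩ := ih _ (hn ▸ hlt) p₁ hx hvY rfl
      exact ⟨U', s', x', y', q, fun w hw => hU₁ w (hsub w hw), rest⟩
    push Not at h1 h2
    exact ⟨U, s, x, y, h, fun _ hv => hv, hx, hy, h1, h2⟩

end PathOn

theorem zmod_two_eq_of_ne {a b c : ZMod 2} (h : a ≠ b) (h' : c ≠ b) : a = c := by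
  revert a b c; decide

/-- In a 3-connected graph, any two sets that are not contained in `{p, q}` are joined by a path
avoiding `p` and `q`. -/
theorem IsVertexConnected.exists_pathOn [Finite V] {G : SimpleGraph V}
    (hG : G.IsVertexConnected 3) (σ : Sym2 V → ZMod 2) {X Y : Set V} {x y p q : V}
    (hx : x ∈ X) (hy : y ∈ Y) (hxp : x ≠ p) (hxq : x ≠ q) (hyp : y ≠ p) (hyq : y ≠ q) :
    ∃ U s x' y', G.PathOn σ U s x' y' ∧ p ∉ U ∧ q ∉ U ∧ x' ∈ X ∧ y' ∈ Y ∧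
      (∀ v, v ∈ U → v ∈ X → v = x') ∧ (∀ v, v ∈ U → v ∈ Y → v = y') := by
  classical
  -- The case `p = q` is allowed and is used below.
  have hc := hG.2 {p, q} (lt_of_le_of_lt Finset.card_le_two (by norm_num))
  have hx' : x ∈ ((({p, q} : Finset V) : Set V)ᶜ) := by simp [hxp, hxq]
  have hy' : y ∈ ((({p, q} : Finset V) : Set V)ᶜ) := by simp [hyp, hyq]
  obtain ⟨w⟩ := hc.preconnected ⟨x, hx'⟩ ⟨y, hy'⟩
  let w' := w.bypass.map (Embedding.induce (G := G) ((({p, q} : Finset V) : Set V)ᶜ)).toHom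
  have hw' : w'.IsPath := w.bypass_isPath.map Subtype.val_injective
  have key : G.PathOn σ {v | v ∈ w'.support} _ x y := ⟨w', hw', fun v => Iff.rfl, rfl⟩
  have hav : ∀ v, v ∈ w'.support → v ≠ p ∧ v ≠ q := by
    intro v hv
    rw [Walk.support_map, List.mem_map] at hv
    obtain ⟨⟨a, ha⟩, -, rfl⟩ := hv
    simpa using ha
  obtain ⟨U, s, x', y', h, hsub, r⟩ := key.trim hx hy
  exact ⟨U, s, x', y', h, fun hp => (hav p (hsub p hp)).1 rfl, fun hq => (hav q (hsub q hq)).2 rfl,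
    r⟩

end SimpleGraph

/-! ### Linkages between two edges -/

namespace SimpleGraph

variable {V : Type*}

/-- There are two disjoint paths inside `A`, starting at the two ends of `e` and ending at `x` and
`y`, whose edge labels sum up to `s`. -/
def TwoPaths (G : SimpleGraph V) (σ : Sym2 V → ZMod 2) (e : Sym2 V) (A : Set V) (s : ZMod 2)
    (x y : V) : Prop :=
  ∃ u v U W a b, s(u, v) = e ∧ G.PathOn σ U a u x ∧ G.PathOn σ W b v y ∧
    (∀ w, w ∈ U → w ∉ W) ∧ (∀ w, w ∈ U → w ∈ A) ∧ (∀ w, w ∈ W → w ∈ A) ∧ a + b = s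

/-- There are two disjoint paths joining the ends of `e` to the ends of `e'`, whose edge labels
sum up to `s`. -/
def Linkage (G : SimpleGraph V) (σ : Sym2 V → ZMod 2) (e e' : Sym2 V) (s : ZMod 2) : Prop :=
  ∃ u v w z U W a b, s(u, v) = e ∧ s(w, z) = e' ∧ G.PathOn σ U a u w ∧ G.PathOn σ W b v z ∧
    (∀ w, w ∈ U → w ∉ W) ∧ a + b = s

/-- There are linkages between `e` and `e'` of both parities. -/
def BothParities (G : SimpleGraph V) (σ : Sym2 V → ZMod 2) (e e' : Sym2 V) : Prop :=
  ∀ s, G.Linkage σ e e' s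

variable {G : SimpleGraph V} {σ : Sym2 V → ZMod 2} {e e' : Sym2 V} {A B X Y : Set V}
  {s t a b : ZMod 2} {x y x' y' : V}

theorem BothParities.of_ne (h : G.Linkage σ e e' s) (h' : G.Linkage σ e e' t) (hst : s ≠ t) :
    G.BothParities σ e e' := by
  intro r
  by_cases hr : r = s
  · exact hr ▸ h
  · rwa [zmod_two_eq_of_ne hr (Ne.symm hst)]

theorem Linkage.symm (h : G.Linkage σ e e' s) : G.Linkage σ e' e s := by
  obtain ⟨u, v, w, z, U, W, a, b, h1, h2, h3, h4, h5⟩ := h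
  exact ⟨w, z, u, v, U, W, a, b, h2, h1, h3.symm, h4.symm, h5⟩

theorem BothParities.symm (h : G.BothParities σ e e') : G.BothParities σ e' e :=
  fun s => (h s).symm

namespace TwoPaths

theorem symm (h : G.TwoPaths σ e A s x y) : G.TwoPaths σ e A s y x := by
  obtain ⟨u, v, U, W, a, b, h1, h2, h3, h4, h5, h6, h7⟩ := h
  exact ⟨v, u, W, U, b, a, by rw [Sym2.eq_swap, h1], h3, h2, fun w hw hw' => h4 w hw' hw, h6, h5,
    by rw [add_comm, h7]⟩

theorem mono (h : G.TwoPaths σ e A s x y) (hAB : ∀ v, v ∈ A → v ∈ B) :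
    G.TwoPaths σ e B s x y := by
  obtain ⟨u, v, U, W, a, b, h1, h2, h3, h4, h5, h6, h7⟩ := h
  exact ⟨u, v, U, W, a, b, h1, h2, h3, h4, fun w hw => hAB w (h5 w hw),
    fun w hw => hAB w (h6 w hw), h7⟩

theorem left_mem (h : G.TwoPaths σ e A s x y) : x ∈ A := by
  obtain ⟨u, v, U, W, a, b, h1, h2, h3, h4, h5, h6, h7⟩ := h
  exact h5 x h2.right_mem

theorem right_mem (h : G.TwoPaths σ e A s x y) : y ∈ A := h.symm.left_mem

theorem ne (h : G.TwoPaths σ e A s x y) : x ≠ y := by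
  obtain ⟨u, v, U, W, a, b, h1, h2, h3, h4, h5, h6, h7⟩ := h
  rintro rfl
  exact h4 x h2.right_mem h3.right_mem

/-- Both paths can be prolonged outside `A`. -/
theorem extend (h : G.TwoPaths σ e A s x y) (hX : G.PathOn σ X a x x') (hY : G.PathOn σ Y b y y')
    (hXA : ∀ v, v ∈ X → v ∈ A → v = x) (hYA : ∀ v, v ∈ Y → v ∈ A → v = y)
    (hXY : ∀ v, v ∈ X → v ∉ Y) (hAB : ∀ v, v ∈ A → v ∈ B) (hXB : ∀ v, v ∈ X → v ∈ B)
    (hYB : ∀ v, v ∈ Y → v ∈ B) (hs : s + a + b = t) : G.TwoPaths σ e B t x' y' := by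
  obtain ⟨u, v, U, W, c, d, h1, h2, h3, h4, h5, h6, h7⟩ := h
  refine ⟨u, v, U ∪ X, W ∪ Y, c + a, d + b, h1,
    h2.append hX fun v hv hv' => hXA v hv' (h5 v hv),
    h3.append hY fun v hv hv' => hYA v hv' (h6 v hv), ?_, ?_, ?_, ?_⟩
  · have := h3.right_mem
    have := h2.right_mem
    grind
  · grind
  · grind
  · rw [← hs, ← h7]; ring

theorem extend_left (h : G.TwoPaths σ e A s x y) (hX : G.PathOn σ X a x x')
    (hXA : ∀ v, v ∈ X → v ∈ A → v = x) (hAB : ∀ v, v ∈ A → v ∈ B) (hXB : ∀ v, v ∈ X → v ∈ B)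
    (hs : s + a = t) : G.TwoPaths σ e B t x' y := by
  refine h.extend hX (PathOn.refl G σ y) hXA (fun v hv _ => hv) ?_ hAB hXB ?_ (by simpa using hs)
  · rintro v hv rfl
    exact h.ne (hXA v hv h.right_mem).symm
  · rintro v rfl
    exact hAB _ h.right_mem

theorem extend_right (h : G.TwoPaths σ e A s x y) (hY : G.PathOn σ Y b y y')
    (hYA : ∀ v, v ∈ Y → v ∈ A → v = y) (hAB : ∀ v, v ∈ A → v ∈ B) (hYB : ∀ v, v ∈ Y → v ∈ B)
    (hs : s + b = t) : G.TwoPaths σ e B t x y' :=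
  (h.symm.extend_left hY hYA hAB hYB hs).symm

/-- Two pairs of disjoint paths are joined to a linkage by two disjoint paths. -/
theorem linkage (h : G.TwoPaths σ e A s x y) (h' : G.TwoPaths σ e' B t x' y')
    (hX : G.PathOn σ X a x x') (hY : G.PathOn σ Y b y y')
    (hXA : ∀ v, v ∈ X → v ∈ A → v = x) (hYA : ∀ v, v ∈ Y → v ∈ A → v = y)
    (hXB : ∀ v, v ∈ X → v ∈ B → v = x') (hYB : ∀ v, v ∈ Y → v ∈ B → v = y')
    (hXY : ∀ v, v ∈ X → v ∉ Y) (hAB : ∀ v, v ∈ A → v ∈ B → v ∈ X ∨ v ∈ Y) :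
    G.Linkage σ e e' (s + t + a + b) := by
  obtain ⟨u, v, U, W, c, d, h1, h2, h3, h4, h5, h6, h7⟩ := h
  obtain ⟨u', v', U', W', c', d', h1', h2', h3', h4', h5', h6', h7'⟩ := h'
  have m1 := h2.right_mem
  have m2 := h3.right_mem
  have m3 := h2'.right_mem
  have m4 := h3'.right_mem
  refine ⟨u, v, u', v', U ∪ X ∪ U', W ∪ Y ∪ W', c + a + c', d + b + d', h1, h1',
    (h2.append hX ?_).append h2'.symm ?_, (h3.append hY ?_).append h3'.symm ?_, ?_, ?_⟩
  · grind
  · grind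
  · grind
  · grind
  · grind
  · rw [← h7, ← h7']; ring

end TwoPaths

/-- Moves a linkage from the edge xy to the next edge yz. A path from z, avoiding y, first hits the
linkage at some m. If m is on the path to x, that path turns off at m to z and the other one still
ends in y. If m is on the path to y, that path turns off to z, and the path to x is prolonged by xy.
-/
theorem Linkage.exists_of_adj [Finite V] (hG : G.IsVertexConnected 3) {x y z : V}
    (h : ∃ s, G.Linkage σ e s(x, y) s) (hxy : G.Adj x y) (hyz : G.Adj y z) :
    ∃ s, G.Linkage σ e s(y, z) s := by
  obtain ⟨s, u, v, w, z', U, W, a, b, h1, h2, h3, h4, h5, -⟩ := h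
  wlog hw : w = x ∧ z' = y generalizing u v w z' U W a b
  · refine this v u z' w W U b a (by rw [Sym2.eq_swap, h1]) (by rw [Sym2.eq_swap, h2]) h4 h3
      (fun w hw hw' => h5 w hw' hw) ?_
    rw [Sym2.eq_iff] at h2
    tauto
  obtain ⟨rfl, rfl⟩ := hw
  have m1 := h3.right_mem
  have m2 := h4.right_mem
  obtain ⟨J, c, z₀, m, hJ, hyJ, -, hz, hm, -, hJm⟩ := hG.exists_pathOn σ (X := {z})
    (Y := {v | (v ∈ U ∨ v ∈ W) ∧ v ≠ z'}) (x := z) (y := w) (p := z') (q := z') rfl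
    ⟨.inl m1, hxy.ne⟩ hyz.ne' hyz.ne' hxy.ne hxy.ne
  obtain rfl : z₀ = z := hz
  obtain ⟨hm, hmz⟩ := hm
  have hJU : ∀ v, v ∈ J → v ∈ U → v = m := fun v h h' =>
    hJm v h ⟨.inl h', fun hv => hyJ (hv ▸ h)⟩
  have hJW : ∀ v, v ∈ J → v ∈ W → v = m := fun v h h' =>
    hJm v h ⟨.inr h', fun hv => hyJ (hv ▸ h)⟩
  clear hJm
  rcases hm with hm | hm
  · obtain ⟨U₁, U₂, a₁, a₂, p₁, p₂, hU₁, hU₂, hU, hd, -⟩ := h3.split hm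
    refine ⟨_, v, u, z', z₀, W, U₁ ∪ J, _, _, by rw [Sym2.eq_swap, h1], rfl, h4,
      p₁.append hJ.symm ?_, ?_, rfl⟩ <;> grind
  · obtain ⟨W₁, W₂, b₁, b₂, p₁, p₂, hW₁, hW₂, hW, hd, -⟩ := h4.split hm
    have := p₂.right_mem
    refine ⟨_, u, v, z', z₀, U ∪ {w, z'}, W₁ ∪ J, _, _, h1, rfl,
      h3.append (PathOn.of_adj σ hxy) ?_, p₁.append hJ.symm ?_, ?_, rfl⟩ <;> grind

/-- Any two edges of a 3-connected graph are linked by two disjoint paths. -/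
theorem Linkage.exists [Finite V] (hG : G.IsVertexConnected 3) (σ : Sym2 V → ZMod 2)
    {a b c d : V} (hab : G.Adj a b) (hcd : G.Adj c d) : ∃ s, G.Linkage σ s(a, b) s(c, d) s := by
  have hconn : ∀ x y, Nonempty (G.Walk x y) := by
    intro x y
    obtain ⟨z, hz⟩ : ∃ z, z ≠ x ∧ z ≠ y := by
      by_contra! h
      have h3 : 3 < Nat.card V := hG.1
      have : (Set.univ : Set V) ⊆ {x, y} := fun z _ => by
        by_cases hz : z = x
        · exact .inl hz
        · exact .inr (h z hz)
      have h4 := (Set.ncard_le_ncard this (Set.toFinite _)).trans (Set.ncard_insert_le _ _)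
      rw [Set.ncard_univ, Set.ncard_singleton] at h4
      omega
    obtain ⟨U, s, x', y', ⟨p, -⟩, -, -, hx, hy, -⟩ := hG.exists_pathOn σ (X := {x}) (Y := {y})
      rfl rfl hz.1.symm hz.1.symm hz.2.symm hz.2.symm
    obtain rfl : x' = x := hx
    obtain rfl : y' = y := hy
    exact ⟨p⟩
  have key : ∀ {x y z : V} (p : G.Walk y z), G.Adj x y → (∃ s, G.Linkage σ s(a, b) s(x, y) s) →
      ∃ w, G.Adj w z ∧ ∃ s, G.Linkage σ s(a, b) s(w, z) s := by
    intro x y z p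
    induction p generalizing x with
    | nil => exact fun h h' => ⟨_, h, h'⟩
    | cons hadj p ih => exact fun h h' => ih hadj (Linkage.exists_of_adj hG h' h hadj)
  obtain ⟨p⟩ := hconn b c
  -- The edge ab is linked to itself by two one-vertex paths; this linkage is carried along a walk
  -- from b to c.
  obtain ⟨w, hw, hl⟩ := key p hab ⟨_, a, b, a, b, {a}, {b}, 0, 0, rfl, rfl, PathOn.refl G σ a,
    PathOn.refl G σ b, fun w hw hw' => hab.ne (hw.symm.trans hw'), rfl⟩
  exact Linkage.exists_of_adj hG hl hw hcd

/-- A linkage between two nonadjacent edges closes up to a cycle through these edges. -/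
theorem Linkage.exists_isCycle (h : G.Linkage σ e e' s) (he : e ∈ G.edgeSet)
    (he' : e' ∈ G.edgeSet) (hne : e ≠ e') :
    ∃ (v : V) (C : G.Walk v v), C.IsCycle ∧ e ∈ C.edges ∧ e' ∈ C.edges ∧
      (C.edges.map σ).sum = s + σ e + σ e' := by
  obtain ⟨u, v, w, z, U, W, a, b, rfl, rfl, ⟨p, hp, hU, ha⟩, ⟨q, hq, hW, hb⟩, hd, rfl⟩ := h
  have hvu : G.Adj v u := (G.mem_edgeSet.1 he).symm
  have hwz : G.Adj w z := G.mem_edgeSet.1 he'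
  have hz : z ∉ U := fun h => hd z h ((hW z).1 q.end_mem_support)
  have hv : v ∉ U := fun h => hd v h ((hW v).1 q.start_mem_support)
  have hu : u ∉ W := fun h => hd u ((hU u).1 p.start_mem_support) h
  have hpq : (p.append (.cons hwz q.reverse)).IsPath := by
    rw [Walk.isPath_def, Walk.support_append, List.nodup_append']
    refine ⟨hp.support_nodup, by simpa using hq.support_nodup, fun x hx hx' => ?_⟩
    exact hd x ((hU x).1 hx) ((hW x).1 (by simpa using hx'))
  refine ⟨v, .cons hvu (p.append (.cons hwz q.reverse)), ?_, ?_, ?_, ?_⟩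
  · rw [Walk.cons_isCycle_iff]
    refine ⟨hpq, fun h => ?_⟩
    rw [Walk.edges_append, Walk.edges_cons, List.mem_append, List.mem_cons] at h
    rcases h with h | h | h
    · exact hv ((hU v).1 (p.fst_mem_support_of_mem_edges h))
    · exact hne (by rw [← h, Sym2.eq_swap])
    · rw [Walk.edges_reverse, List.mem_reverse] at h
      exact hu ((hW u).1 (q.snd_mem_support_of_mem_edges h))
  · simp [Sym2.eq_swap]
  · simp
  · simp only [Walk.edges_cons, Walk.edges_append, Walk.edges_reverse, List.map_cons,
      List.map_append, List.map_reverse, List.sum_cons, List.sum_append, List.sum_reverse, ha, hb]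
    rw [Sym2.eq_swap]
    ring

end SimpleGraph

/-! ### Hubs: pieces with exits governed by a potential -/

namespace SimpleGraph

variable {V : Type*}

theorem zmod_two_ne_iff {a b : ZMod 2} : a ≠ b ↔ a = b + 1 := by
  revert a b; decide

/-- Partial sums of labels along a path. -/
theorem PathOn.exists_partial_sums {G : SimpleGraph V} {σ : Sym2 V → ZMod 2} {U : Set V}
    {s : ZMod 2} {x y : V} (h : G.PathOn σ U s x y) :
    ∃ φ : V → ZMod 2, φ x = 0 ∧ φ y = s ∧ ∀ v, v ∈ U → ∃ U₁ U₂, G.PathOn σ U₁ (φ v) x v ∧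
      G.PathOn σ U₂ (s + φ v) v y ∧ (∀ w, w ∈ U₁ → w ∈ U) ∧ (∀ w, w ∈ U₂ → w ∈ U) ∧
      (∀ w, w ∈ U → w ∈ U₁ ∨ w ∈ U₂) ∧ (∀ w, w ∈ U₁ → w ∈ U₂ → w = v) := by
  have key : ∀ v, ∃ c, v ∈ U → ∃ U₁ U₂, G.PathOn σ U₁ c x v ∧
      G.PathOn σ U₂ (s + c) v y ∧ (∀ w, w ∈ U₁ → w ∈ U) ∧ (∀ w, w ∈ U₂ → w ∈ U) ∧
      (∀ w, w ∈ U → w ∈ U₁ ∨ w ∈ U₂) ∧ (∀ w, w ∈ U₁ → w ∈ U₂ → w = v) := by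
    intro v
    by_cases hv : v ∈ U
    · obtain ⟨U₁, U₂, s₁, s₂, p₁, p₂, h1, h2, h3, h4, rfl⟩ := h.split hv
      exact ⟨s₁, fun _ => ⟨U₁, U₂, p₁, by rwa [show s₁ + s₂ + s₁ = s₂ by grind], h1, h2, h3, h4⟩⟩
    · exact ⟨0, fun h => absurd h hv⟩
  choose φ hφ using key
  refine ⟨φ, ?_, ?_, hφ⟩
  · obtain ⟨U₁, U₂, p₁, -⟩ := hφ x h.left_mem
    exact p₁.eq_zero_of_loop.2
  · obtain ⟨U₁, U₂, -, p₂, -⟩ := hφ y h.right_mem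
    have := p₂.eq_zero_of_loop.2
    grind

/-- `A` is a piece of the graph containing the ends of `e` from which one can leave by any two
vertices of which at least one is in the frontier `{p, q}`, with labels governed by the
potential `f`; apart from the frontier vertex used, the paths avoid the set `Z`. -/
structure Hub (G : SimpleGraph V) (σ : Sym2 V → ZMod 2) (e : Sym2 V) (A Z : Set V)
    (f : V → ZMod 2) (k : ZMod 2) (p q : V) : Prop where
  main : G.TwoPaths σ e A (k + f p + f q) p q
  left : ∀ l, l ∈ A → l ≠ p → l ≠ q →
    G.TwoPaths σ e {v | v ∈ A ∧ (v ∈ Z → v = p)} (k + f l + f p) l p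
  right : ∀ l, l ∈ A → l ≠ p → l ≠ q →
    G.TwoPaths σ e {v | v ∈ A ∧ (v ∈ Z → v = q)} (k + f l + f q) l q

variable {G : SimpleGraph V} {σ : Sym2 V → ZMod 2} {e e' : Sym2 V} {A B Z N J M₁ M₂ : Set V}
  {f g : V → ZMod 2} {k k' n t s₁ s₂ : ZMod 2} {p q p' q' m j : V}

theorem Hub.swap (h : G.Hub σ e A Z f k p q) : G.Hub σ e A Z f k q p where
  main := by rw [add_right_comm]; exact h.main.symm
  left l hl h1 h2 := h.right l hl h2 h1
  right l hl h1 h2 := h.left l hl h2 h1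

/-- A hub grows along two paths that leave it and meet at `m`. -/
theorem Hub.extend (h : G.Hub σ e A Z f k p q) (hN : G.PathOn σ N n p m)
    (hJ : G.PathOn σ J t j m) (hj : j ∈ A) (hjp : j ≠ p) (hjq : j ≠ q) (hpm : p ≠ m)
    (hNA : ∀ v, v ∈ N → v ∈ A → v = p) (hJA : ∀ v, v ∈ J → v ∈ A → v = j)
    (hNJ : ∀ v, v ∈ N → v ∈ J → v = m) (hNZ : ∀ v, v ∈ N → v ∈ Z → v = m)
    (hJZ : ∀ v, v ∈ J → v ∈ Z → v = m) (hAZ : ∀ v, v ∈ A → v ∈ Z → v = q)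
    (hs : f p + n = f j + t) :
    ∃ f', G.Hub σ e (A ∪ N ∪ J) Z f' k m q ∧ f' m = f p + n ∧ f' q = f q := by
  classical
  obtain ⟨φ, φp, φm, hφ⟩ := hN.exists_partial_sums
  obtain ⟨ψ, ψj, ψm, hψ⟩ := hJ.exists_partial_sums
  -- The potential is continued along `N` from p and along `J` from j; `hs` says that both give the
  -- same value at m.
  let f' : V → ZMod 2 := fun v => if v ∈ A then f v else if v ∈ N then f p + φ v else f j + ψ v
  have hfA : ∀ v, v ∈ A → f' v = f v := fun v hv => if_pos hv
  have hfN : ∀ v, v ∈ N → f' v = f p + φ v := by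
    intro v hv
    by_cases hv' : v ∈ A
    · obtain rfl := hNA v hv hv'
      simp [hfA v hv', φp]
    · simp [f', hv, hv']
  have hfJ : ∀ v, v ∈ J → f' v = f j + ψ v := by
    intro v hv
    by_cases hv' : v ∈ A
    · obtain rfl := hJA v hv hv'
      simp [hfA v hv', ψj]
    · by_cases hv'' : v ∈ N
      · obtain rfl := hNJ v hv'' hv
        rw [hfN v hv'', φm, ψm, hs]
      · simp [f', hv', hv'']
  have hfm : f' m = f p + n := by rw [hfN m hN.right_mem, φm]
  have hp := h.main.left_mem
  have hq := h.main.right_mem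
  have hpq := h.main.ne
  have hmN := hN.right_mem
  have hmJ := hJ.right_mem
  have hpN := hN.left_mem
  have hjJ := hJ.left_mem
  clear_value f'
  refine ⟨f', ⟨?_, ?_, ?_⟩, hfm, hfA q hq⟩
  · exact h.main.extend_left hN hNA (by grind) (by grind) (by grind)
  · intro l hl hlm hlq
    by_cases hlA : l ∈ A
    · by_cases hlp : l = p
      -- The old frontier vertex p is now an ordinary exit: leave `A` through p and j, and follow
      -- `J` to the new frontier vertex m.
      · subst hlp
        exact (h.left j hj hjp hjq).symm.extend_right hJ (by grind) (by grind) (by grind) (by grind)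
      · exact (h.left l hlA hlp hlq).extend_right hN (by grind) (by grind) (by grind) (by grind)
    · by_cases hlN : l ∈ N
      · obtain ⟨N₁, N₂, p₁, p₂, h1, h2⟩ := hφ l hlN
        have := p₂.right_mem
        exact (h.left j hj hjp hjq).symm.extend p₁ hJ (by grind) (by grind) (by grind) (by grind)
          (by grind) (by grind) (by grind)
      · have hlJ : l ∈ J := by grind
        obtain ⟨J₁, J₂, p₁, p₂, h1, h2⟩ := hψ l hlJ
        have := p₂.right_mem
        exact (h.left j hj hjp hjq).extend p₁ hN (by grind) (by grind) (by grind) (by grind)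
          (by grind) (by grind) (by grind)
  · intro l hl hlm hlq
    by_cases hlA : l ∈ A
    · by_cases hlp : l = p
      · subst hlp
        exact (by grind : k + f l + f q = k + f' l + f' q) ▸ h.main.mono (by grind)
      · exact (by grind : k + f l + f q = k + f' l + f' q) ▸
          (h.right l hlA hlp hlq).mono (by grind)
    · by_cases hlN : l ∈ N
      · obtain ⟨N₁, N₂, p₁, p₂, h1, h2⟩ := hφ l hlN
        have := p₂.right_mem
        exact h.main.extend_left p₁ (by grind) (by grind) (by grind) (by grind)
      · have hlJ : l ∈ J := by grind
        obtain ⟨J₁, J₂, p₁, p₂, h1, h2⟩ := hψ l hlJ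
        have := p₂.right_mem
        exact (h.right j hj hjp hjq).extend_left p₁ (by grind) (by grind) (by grind) (by grind)

set_option maxHeartbeats 1000000 in
/-- Two hubs joined by two disjoint paths that close up to an odd cycle give linkages of both
parities. -/
theorem Hub.bothParities [Finite V] (hG : G.IsVertexConnected 3)
    (hA : G.Hub σ e A B f k p q) (hB : G.Hub σ e' B ∅ g k' p' q')
    (h₁ : G.PathOn σ M₁ s₁ p p') (h₂ : G.PathOn σ M₂ s₂ q q')
    (hM : ∀ v, v ∈ M₁ → v ∉ M₂)
    (hM₁A : ∀ v, v ∈ M₁ → v ∈ A → v = p) (hM₂A : ∀ v, v ∈ M₂ → v ∈ A → v = q)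
    (hM₁B : ∀ v, v ∈ M₁ → v ∈ B → v = p') (hM₂B : ∀ v, v ∈ M₂ → v ∈ B → v = q')
    (hAB : ∀ v, v ∈ A → v ∈ B → v ∈ M₁ ∨ v ∈ M₂)
    (hA' : ∃ l, l ∈ A ∧ l ≠ p ∧ l ≠ q) (hB' : ∃ l, l ∈ B ∧ l ≠ p' ∧ l ≠ q')
    (hne : f p + s₁ + g p' ≠ f q + s₂ + g q') : G.BothParities σ e e' := by
  induction hn : M₁.ncard + M₂.ncard using Nat.strong_induction_on
    generalizing A f p q M₁ M₂ s₁ s₂ p' q' with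
  | _ n ih =>
  rw [zmod_two_ne_iff] at hne
  have hpA := hA.main.left_mem
  have hqA := hA.main.right_mem
  have hpB := hB.main.left_mem
  have hqB := hB.main.right_mem
  have hpq := hA.main.ne
  have hpq' := hB.main.ne
  have hp₁ := h₁.left_mem
  have hp₁' := h₁.right_mem
  have hq₂ := h₂.left_mem
  have hq₂' := h₂.right_mem
  obtain ⟨l, hl, hlp, hlq⟩ := id hA'
  obtain ⟨l', hl', hlp', hlq'⟩ := id hB'
  -- {p, q} does not separate the first hub from the rest, so there is a third way out.
  obtain ⟨J, t, j, m, hJ, hpJ, hqJ, hjA, hm, hJA, hJm⟩ := hG.exists_pathOn σ (X := A)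
    (Y := B ∪ M₁ ∪ M₂) (x := l) (y := l') (p := p) (q := q) hl (by grind) hlp hlq
    (by grind) (by grind)
  have hjJ := hJ.left_mem
  have hmJ := hJ.right_mem
  -- The case where `J` ends on a connecting path, quantified anew so that it also applies with the
  -- two paths exchanged.
  have grow : ∀ {M₁ M₂ : Set V} {s₁ s₂ : ZMod 2} {p q p' q' : V}, G.Hub σ e A B f k p q →
      G.Hub σ e' B ∅ g k' p' q' → G.PathOn σ M₁ s₁ p p' → G.PathOn σ M₂ s₂ q q' →
      (∀ v, v ∈ M₁ → v ∉ M₂) → (∀ v, v ∈ M₁ → v ∈ A → v = p) → (∀ v, v ∈ M₂ → v ∈ A → v = q) →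
      (∀ v, v ∈ M₁ → v ∈ B → v = p') → (∀ v, v ∈ M₂ → v ∈ B → v = q') →
      (∀ v, v ∈ A → v ∈ B → v ∈ M₁ ∨ v ∈ M₂) → (∃ l, l ∈ B ∧ l ≠ p' ∧ l ≠ q') →
      f p + s₁ + g p' = f q + s₂ + g q' + 1 → M₁.ncard + M₂.ncard = n → p ∉ J → q ∉ J →
      (∀ v, v ∈ J → v ∈ B ∪ M₁ ∪ M₂ → v = m) → m ∈ M₁ → G.BothParities σ e e' := by
    intro M₁ M₂ s₁ s₂ p q p' q' hA hB h₁ h₂ hM hM₁A hM₂A hM₁B hM₂B hAB hB' hne hn hpJ hqJ hJm hmM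
    have hpA := hA.main.left_mem
    have hqA := hA.main.right_mem
    have hpB := hB.main.left_mem
    have hqB := hB.main.right_mem
    have hpq := hA.main.ne
    have hpq' := hB.main.ne
    have hp₁ := h₁.left_mem
    have hp₁' := h₁.right_mem
    have hq₂ := h₂.left_mem
    have hq₂' := h₂.right_mem
    have hpm : p ≠ m := by grind
    obtain ⟨N, N', n₁, n₂, hN, hN', hU₁, hU₂, hU, hd, rfl⟩ := h₁.split hmM
    have hpN := hN.left_mem
    have hmN := hN.right_mem
    have hmN' := hN'.left_mem
    have hpN' := hN'.right_mem
    have hpB' : p ∉ B := by grind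
    -- If reaching m through p and through j agrees with the potential, the hub absorbs both routes
    -- and its frontier advances from p to m. Otherwise the two routes give linkages of different
    -- parity.
    by_cases hs : f p + n₁ = f j + t
    · obtain ⟨f', hf', hfm, hfq⟩ := hA.extend hN hJ hjA (by grind) (by grind) hpm (by grind)
        (by grind) (by grind) (by grind) (by grind) (by grind) hs
      refine ih _ ?_ hf' hB hN' h₂ (by grind) (by grind) (by grind) (by grind) (by grind)
        (by grind) ⟨p, by grind, hpm, hpq⟩ hB' ?_ rfl
      · have : N'.ncard < M₁.ncard :=
          PathOn.ncard_lt_of_split hU₂ hp₁ (by grind)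
        omega
      · rw [zmod_two_ne_iff]; grind
    · have l₁ := hA.main.linkage hB.main h₁ h₂ (by grind) (by grind) (by grind) (by grind)
        (by grind) (by grind)
      have l₂ := (hA.right j hjA (by grind) (by grind)).linkage hB.main
        (hJ.append hN' (by grind)) h₂ (by grind) (by grind) (by grind) (by grind)
        (by grind) (by grind)
      refine BothParities.of_ne l₁ l₂ fun hc => hs ?_
      grind
  by_cases hm₁ : m ∈ M₁
  · exact grow hA hB h₁ h₂ hM hM₁A hM₂A hM₁B hM₂B hAB hB' hne hn hpJ hqJ hJm hm₁
  by_cases hm₂ : m ∈ M₂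
  · exact grow hA.swap hB.swap h₂ h₁ (fun v h h' => hM v h' h) hM₂A hM₁A hM₂B hM₁B
      (fun v h h' => (hAB v h h').symm) (by grind) (by grind) (by omega) hqJ hpJ (by grind) hm₂
  have hmB : m ∈ B := by grind
  -- `J` reaches the second hub directly. Combining it with `M₁` or with `M₂` gives linkages that
  -- differ in the odd closed connection. The unused frontier vertex of the first hub may already
  -- lie on `B`; the paths inside the first hub avoid it by the condition on the avoided set.
  have l₁ := (hA.left j hjA (by grind) (by grind)).linkage
    (hB.left m hmB (by grind) (by grind)) hJ h₁ (by grind) (by grind) (by grind) (by grind)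
    (by grind) (by grind)
  have l₂ := (hA.right j hjA (by grind) (by grind)).linkage
    (hB.right m hmB (by grind) (by grind)) hJ h₂ (by grind) (by grind) (by grind) (by grind)
    (by grind) (by grind)
  refine BothParities.of_ne l₁ l₂ ?_
  rw [zmod_two_ne_iff]
  grind

end SimpleGraph

/-! ### Cutting paths; disjoint rungs, parallel or crossing -/

namespace SimpleGraph

variable {V : Type*}

/-- A path from `x` to `y`, cut at `v` and `w` in this order, into pieces whose labels are given by
partial sums `φ`. -/
def CutPath (G : SimpleGraph V) (σ : Sym2 V → ZMod 2) (U : Set V) (φ : V → ZMod 2) (s : ZMod 2)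
    (x v w y : V) : Prop :=
  ∃ U₁ U₂ U₃, G.PathOn σ U₁ (φ v) x v ∧ G.PathOn σ U₂ (φ v + φ w) v w ∧
    G.PathOn σ U₃ (s + φ w) w y ∧ (∀ z, z ∈ U₁ → z ∈ U) ∧ (∀ z, z ∈ U₂ → z ∈ U) ∧
    (∀ z, z ∈ U₃ → z ∈ U) ∧ (∀ z, z ∈ U → z ∈ U₁ ∨ z ∈ U₂ ∨ z ∈ U₃) ∧
    (∀ z, z ∈ U₁ → z ∈ U₂ → z = v) ∧ (∀ z, z ∈ U₂ → z ∈ U₃ → z = w) ∧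
    (∀ z, z ∈ U₁ → z ∈ U₃ → z = v ∧ z = w)

/-- Partial sums of labels along a path, describing all subpaths. -/
theorem PathOn.exists_cutPath {G : SimpleGraph V} {σ : Sym2 V → ZMod 2} {U : Set V}
    {s : ZMod 2} {x y : V} (h : G.PathOn σ U s x y) :
    ∃ φ : V → ZMod 2, ∀ v w, v ∈ U → w ∈ U →
      G.CutPath σ U φ s x v w y ∨ G.CutPath σ U φ s x w v y := by
  classical
  obtain ⟨p, hp, hU, hs⟩ := h
  induction p generalizing U s with
  | @nil x =>
    refine ⟨fun _ => 0, fun v w hv hw => .inl ?_⟩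
    have h0 : ∀ z, z ∈ U ↔ z = x := fun z => by rw [← hU]; simp
    obtain rfl := (h0 v).1 hv
    obtain rfl := (h0 w).1 hw
    have hs' : s = 0 := by simpa using hs.symm
    subst hs'
    refine ⟨{w}, {w}, {w}, PathOn.refl G σ w, by simpa using PathOn.refl G σ w,
      by simpa using PathOn.refl G σ w, ?_, ?_, ?_, ?_, ?_, ?_, ?_⟩ <;> grind
  | @cons x x₁ y hadj q ih =>
    rw [Walk.cons_isPath_iff] at hp
    obtain ⟨φ, hφ⟩ := ih (U := {v | v ∈ q.support}) (s := (q.edges.map σ).sum) hp.1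
      (fun v => Iff.rfl) rfl
    have hxq : x ∉ {v | v ∈ q.support} := hp.2
    have hU' : ∀ v, v ∈ U ↔ v = x ∨ v ∈ {v | v ∈ q.support} := fun v => by rw [← hU]; simp
    have hs' : s = σ s(x, x₁) + (q.edges.map σ).sum := by rw [← hs]; simp
    generalize {v | v ∈ q.support} = Q at hφ hxq hU'
    generalize (q.edges.map σ).sum = c at hφ hs'
    have hx₁ : x ≠ x₁ := hadj.ne
    have hE := PathOn.of_adj σ hadj
    let φ' : V → ZMod 2 := fun v => if v = x then 0 else σ s(x, x₁) + φ v
    have hφx : φ' x = 0 := if_pos rfl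
    have hφQ : ∀ v, v ∈ Q → φ' v = σ s(x, x₁) + φ v := by
      intro v hv
      exact if_neg (by rintro rfl; exact hxq hv)
    have two : ∀ v w, v ∈ Q → w ∈ Q → G.CutPath σ Q φ c x₁ v w y →
        G.CutPath σ U φ' s x v w y := by
      rintro v w hv hw ⟨U₁, U₂, U₃, p₁, p₂, p₃, h1, h2, h3, h4⟩
      have := p₁.left_mem
      refine ⟨{x, x₁} ∪ U₁, U₂, U₃, ?_, ?_, ?_, ?_, ?_, ?_, ?_, ?_, ?_, ?_⟩
      · rw [hφQ v hv]
        exact hE.append p₁ (by grind)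
      · rwa [hφQ v hv, hφQ w hw, show σ s(x, x₁) + φ v + (σ s(x, x₁) + φ w) = φ v + φ w by grind]
      · rwa [hφQ w hw, hs', show σ s(x, x₁) + c + (σ s(x, x₁) + φ w) = c + φ w by grind]
      all_goals grind
    have one : ∀ w, w ∈ Q → G.CutPath σ U φ' s x x w y := by
      intro w hw
      obtain ⟨U₁, U₂, U₃, p₁, p₂, p₃, h1, h2, h3, h4⟩ := (hφ w w hw hw).elim id id
      have h5 := p₂.eq_zero_of_loop.1
      have := p₁.left_mem
      have := p₁.right_mem
      refine ⟨{x}, {x, x₁} ∪ U₁, U₃, ?_, ?_, ?_, ?_, ?_, ?_, ?_, ?_, ?_, ?_⟩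
      · rw [hφx]; exact PathOn.refl G σ x
      · rw [hφx, hφQ w hw, zero_add]
        exact hE.append p₁ (by grind)
      · rwa [hφQ w hw, hs', show σ s(x, x₁) + c + (σ s(x, x₁) + φ w) = c + φ w by grind]
      all_goals grind
    refine ⟨φ', fun v w hv hw => ?_⟩
    rcases (hU' v).1 hv with rfl | hv
    · rcases (hU' w).1 hw with rfl | hw
      · left
        refine ⟨{w}, {w}, U, ?_, ?_, ?_, ?_, ?_, ?_, ?_, ?_, ?_, ?_⟩
        · rw [hφx]; exact PathOn.refl G σ w
        · rw [hφx]; exact PathOn.refl G σ w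
        · rw [hφx, add_zero]; exact ⟨.cons hadj q, by simpa using hp, hU, hs⟩
        all_goals grind
      · exact .inl (one w hw)
    · rcases (hU' w).1 hw with rfl | hw
      · exact .inr (one v hv)
      · exact (hφ v w hv hw).imp (two v w hv hw) (two w v hw hv)

variable {G : SimpleGraph V} {σ : Sym2 V → ZMod 2} {e e' : Sym2 V}

/-- Two disjoint paths starting at the ends of `e` and a path joining their last vertices form a
hub. -/
theorem Hub.of_rung {P Q R : Set V} {a b r : ZMod 2} {u v x y : V} (he : s(u, v) = e)
    (hP : G.PathOn σ P a u x) (hQ : G.PathOn σ Q b v y) (hR : G.PathOn σ R r x y)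
    (hPQ : ∀ w, w ∈ P → w ∉ Q) (hRP : ∀ w, w ∈ R → w ∈ P → w = x)
    (hRQ : ∀ w, w ∈ R → w ∈ Q → w = y) :
    ∃ f k, G.Hub σ e (P ∪ Q ∪ R) ∅ f k x y ∧ f x = 0 ∧ f y = r := by
  classical
  obtain ⟨φ, -, φx, hφ⟩ := hP.exists_partial_sums
  obtain ⟨χ, -, χy, hχ⟩ := hQ.exists_partial_sums
  obtain ⟨ρ, ρx, ρy, hρ⟩ := hR.exists_partial_sums
  have m1 := hP.right_mem
  have m2 := hQ.right_mem
  have m3 := hR.left_mem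
  have m4 := hR.right_mem
  -- P ∪ R ∪ Q is itself a path from u through x and y to v; the potential is the label of the part
  -- between w and x.
  let f : V → ZMod 2 := fun w => if w ∈ P then a + φ w else if w ∈ Q then r + b + χ w else ρ w
  have hfP : ∀ w, w ∈ P → f w = a + φ w := fun w hw => if_pos hw
  have hfQ : ∀ w, w ∈ Q → f w = r + b + χ w := fun w hw => by
    have : w ∉ P := fun h => hPQ w h hw
    simp [f, hw, this]
  have hfR : ∀ w, w ∈ R → w ≠ x → w ≠ y → f w = ρ w := fun w hw h h' => by
    have h1 : w ∉ P := fun h => by grind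
    have h2 : w ∉ Q := fun h => by grind
    simp [f, h1, h2]
  have hfx : f x = 0 := by rw [hfP x m1]; grind
  have hfy : f y = r := by rw [hfQ y m2]; grind
  clear_value f
  refine ⟨f, a + b + r, ⟨?_, ?_, ?_⟩, hfx, hfy⟩
  · exact ⟨u, v, P, Q, a, b, he, hP, hQ, hPQ, by grind, by grind, by grind⟩
  · intro l hl hlx hly
    by_cases hlP : l ∈ P
    · obtain ⟨P₁, P₂, p₁, p₂, h1, h2⟩ := hφ l hlP
      have := p₂.right_mem
      exact ⟨u, v, P₁, Q ∪ R, φ l, b + r, he, p₁, hQ.append hR.symm (by grind), by grind, by grind,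
        by grind, by grind⟩
    by_cases hlQ : l ∈ Q
    · obtain ⟨Q₁, Q₂, p₁, p₂, h1, h2⟩ := hχ l hlQ
      exact ⟨v, u, Q₁, P, χ l, a, by rw [Sym2.eq_swap, he], p₁, hP, by grind, by grind,
        by grind, by grind⟩
    · obtain ⟨R₁, R₂, p₁, p₂, h1, h2⟩ := hρ l (by grind)
      have := p₁.left_mem
      exact ⟨v, u, Q ∪ R₂, P, b + (r + ρ l), a, by rw [Sym2.eq_swap, he],
        hQ.append p₂.symm (by grind), hP, by grind, by grind, by grind, by grind⟩
  · intro l hl hlx hly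
    by_cases hlP : l ∈ P
    · obtain ⟨P₁, P₂, p₁, p₂, h1, h2⟩ := hφ l hlP
      exact ⟨u, v, P₁, Q, φ l, b, he, p₁, hQ, by grind, by grind, by grind, by grind⟩
    by_cases hlQ : l ∈ Q
    · obtain ⟨Q₁, Q₂, p₁, p₂, h1, h2⟩ := hχ l hlQ
      have := p₂.right_mem
      exact ⟨v, u, Q₁, P ∪ R, χ l, a + r, by rw [Sym2.eq_swap, he], p₁, hP.append hR (by grind),
        by grind, by grind, by grind, by grind⟩
    · obtain ⟨R₁, R₂, p₁, p₂, h1, h2⟩ := hρ l (by grind)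
      have := p₂.right_mem
      exact ⟨u, v, P ∪ R₁, Q, a + ρ l, b, he, hP.append p₁ (by grind), hQ, by grind,
        by grind, by grind, by grind⟩

variable {P₁ M₁ P₂ Q₁ M₂ Q₂ R₁ R₂ : Set V} {a₁ m₁ a₂ b₁ m₂ b₂ r₁ r₂ : ZMod 2}
  {u v w z x₁ x₂ y₁ y₂ : V}

/-- Two disjoint noncrossing rungs between two linking paths. -/
theorem bothParities_of_parallel_rungs [Finite V] (hG : G.IsVertexConnected 3)
    (he : s(u, v) = e) (he' : s(w, z) = e')
    (hP₁ : G.PathOn σ P₁ a₁ u x₁) (hM₁ : G.PathOn σ M₁ m₁ x₁ x₂) (hP₂ : G.PathOn σ P₂ a₂ x₂ w)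
    (hQ₁ : G.PathOn σ Q₁ b₁ v y₁) (hM₂ : G.PathOn σ M₂ m₂ y₁ y₂) (hQ₂ : G.PathOn σ Q₂ b₂ y₂ z)
    (hR₁ : G.PathOn σ R₁ r₁ x₁ y₁) (hR₂ : G.PathOn σ R₂ r₂ x₂ y₂)
    (hPQ : ∀ t, t ∈ P₁ ∪ M₁ ∪ P₂ → t ∉ Q₁ ∪ M₂ ∪ Q₂)
    (hPM : ∀ t, t ∈ P₁ → t ∈ M₁ → t = x₁) (hMP : ∀ t, t ∈ M₁ → t ∈ P₂ → t = x₂)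
    (hPP : ∀ t, t ∈ P₁ → t ∉ P₂)
    (hQM : ∀ t, t ∈ Q₁ → t ∈ M₂ → t = y₁) (hMQ : ∀ t, t ∈ M₂ → t ∈ Q₂ → t = y₂)
    (hQQ : ∀ t, t ∈ Q₁ → t ∉ Q₂)
    (hRP₁ : ∀ t, t ∈ R₁ → t ∈ P₁ ∪ M₁ ∪ P₂ → t = x₁)
    (hRQ₁ : ∀ t, t ∈ R₁ → t ∈ Q₁ ∪ M₂ ∪ Q₂ → t = y₁)
    (hRP₂ : ∀ t, t ∈ R₂ → t ∈ P₁ ∪ M₁ ∪ P₂ → t = x₂)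
    (hRQ₂ : ∀ t, t ∈ R₂ → t ∈ Q₁ ∪ M₂ ∪ Q₂ → t = y₂)
    (hRR : ∀ t, t ∈ R₁ → t ∉ R₂)
    (h₁ : ∃ t, t ∈ P₁ ∪ Q₁ ∪ R₁ ∧ t ≠ x₁ ∧ t ≠ y₁) (h₂ : ∃ t, t ∈ P₂ ∪ Q₂ ∪ R₂ ∧ t ≠ x₂ ∧ t ≠ y₂)
    (hs : r₁ + r₂ + m₁ + m₂ = 1) : G.BothParities σ e e' := by
  subst he he'
  simp only [Set.mem_union, or_imp, forall_and, not_or] at hPQ hRP₁ hRQ₁ hRP₂ hRQ₂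
  obtain ⟨f, k, hA, fx, fy⟩ := Hub.of_rung rfl hP₁ hQ₁ hR₁ (by grind) (by grind) (by grind)
  obtain ⟨g, k', hB, gx, gy⟩ := Hub.of_rung rfl hP₂.symm hQ₂.symm hR₂ (by grind) (by grind)
    (by grind)
  have hd : ∀ t, t ∈ P₁ ∪ Q₁ ∪ R₁ → t ∉ P₂ ∪ Q₂ ∪ R₂ := by grind
  -- The two hubs are disjoint, so avoiding the second one costs nothing at the start.
  have hA' : G.Hub σ s(u, v) (P₁ ∪ Q₁ ∪ R₁) (P₂ ∪ Q₂ ∪ R₂) f k x₁ y₁ :=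
    ⟨hA.main, fun l h h' h'' => (hA.left l h h' h'').mono (by grind),
      fun l h h' h'' => (hA.right l h h' h'').mono (by grind)⟩
  refine hA'.bothParities hG hB hM₁ hM₂ (by grind) (by grind) (by grind) (by grind) (by grind)
    (by grind) h₁ h₂ ?_
  rw [zmod_two_ne_iff]
  grind

/-- Two disjoint crossing rungs between two linking paths. -/
theorem bothParities_of_crossing_rungs
    (he : s(u, v) = e) (he' : s(w, z) = e')
    (hP₁ : G.PathOn σ P₁ a₁ u x₁) (hM₁ : G.PathOn σ M₁ m₁ x₁ x₂) (hP₂ : G.PathOn σ P₂ a₂ x₂ w)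
    (hQ₁ : G.PathOn σ Q₁ b₁ v y₂) (hM₂ : G.PathOn σ M₂ m₂ y₂ y₁) (hQ₂ : G.PathOn σ Q₂ b₂ y₁ z)
    (hR₁ : G.PathOn σ R₁ r₁ x₁ y₁) (hR₂ : G.PathOn σ R₂ r₂ x₂ y₂)
    (hPQ : ∀ t, t ∈ P₁ ∪ M₁ ∪ P₂ → t ∉ Q₁ ∪ M₂ ∪ Q₂)
    (hPM : ∀ t, t ∈ P₁ → t ∈ M₁ → t = x₁) (hMP : ∀ t, t ∈ M₁ → t ∈ P₂ → t = x₂)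
    (hPP : ∀ t, t ∈ P₁ → t ∉ P₂)
    (hQM : ∀ t, t ∈ Q₁ → t ∈ M₂ → t = y₂) (hMQ : ∀ t, t ∈ M₂ → t ∈ Q₂ → t = y₁)
    (hQQ : ∀ t, t ∈ Q₁ → t ∉ Q₂)
    (hRP₁ : ∀ t, t ∈ R₁ → t ∈ P₁ ∪ M₁ ∪ P₂ → t = x₁)
    (hRQ₁ : ∀ t, t ∈ R₁ → t ∈ Q₁ ∪ M₂ ∪ Q₂ → t = y₁)
    (hRP₂ : ∀ t, t ∈ R₂ → t ∈ P₁ ∪ M₁ ∪ P₂ → t = x₂)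
    (hRQ₂ : ∀ t, t ∈ R₂ → t ∈ Q₁ ∪ M₂ ∪ Q₂ → t = y₂)
    (hRR : ∀ t, t ∈ R₁ → t ∉ R₂)
    (hs : r₁ + r₂ + m₁ + m₂ = 1) : G.BothParities σ e e' := by
  subst he he'
  simp only [Set.mem_union, or_imp, forall_and, not_or] at hPQ hRP₁ hRQ₁ hRP₂ hRQ₂
  have l₁ : G.Linkage σ s(u, v) s(w, z) (a₁ + m₁ + a₂ + (b₁ + m₂ + b₂)) :=
    ⟨u, v, w, z, P₁ ∪ M₁ ∪ P₂, Q₁ ∪ M₂ ∪ Q₂, _, _, rfl, rfl,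
      (hP₁.append hM₁ (by grind)).append hP₂ (by grind),
      (hQ₁.append hM₂ (by grind)).append hQ₂ (by grind), by grind, rfl⟩
  -- Both paths change sides along the rungs, so the ends of the second edge are exchanged and `m₁ +
  -- m₂` is replaced by `r₁ + r₂`.
  have l₂ : G.Linkage σ s(u, v) s(w, z) (a₁ + r₁ + b₂ + (b₁ + r₂ + a₂)) :=
    ⟨u, v, z, w, P₁ ∪ R₁ ∪ Q₂, Q₁ ∪ R₂ ∪ P₂, _, _, rfl, Sym2.eq_swap,
      (hP₁.append hR₁ (by grind)).append hQ₂ (by grind),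
      (hQ₁.append hR₂.symm (by grind)).append hP₂ (by grind), by grind, rfl⟩
  refine BothParities.of_ne l₁ l₂ ?_
  rw [zmod_two_ne_iff]
  grind

end SimpleGraph

/-! ### Growing a hub for rungs with a common end -/

namespace SimpleGraph

variable {V : Type*} {G : SimpleGraph V} {σ : Sym2 V → ZMod 2} {e e' : Sym2 V}

set_option maxHeartbeats 1000000 in
/-- A hub built from a set `S` with weaker exit properties, by attaching a path from `t` that
forks at `x` towards `p` and `y`, and a path from `j` to `p`. -/
theorem Hub.of_fork {S N M R J Z : Set V} {n m r d c : ZMod 2} {t x p y j : V} {φ : V → ZMod 2}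
    (hty : G.TwoPaths σ e S c t y)
    (hS : ∀ l, l ∈ S → l ≠ t → l ≠ y → G.TwoPaths σ e {v | v ∈ S ∧ v ≠ y} (φ l) l t)
    (hj : j ∈ S) (hjt : j ≠ t) (hjy : j ≠ y)
    (hN : G.PathOn σ N n t x) (hM : G.PathOn σ M m x p) (hR : G.PathOn σ R r x y)
    (hJ : G.PathOn σ J d j p)
    (hNS : ∀ v, v ∈ N → v ∈ S → v = t) (hMS : ∀ v, v ∈ M → v ∈ S → v = t)
    (hRS : ∀ v, v ∈ R → v ∈ S → v = t ∨ v = y) (hJS : ∀ v, v ∈ J → v ∈ S → v = j)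
    (hNJ : ∀ v, v ∈ N → v ∉ J) (hMJ : ∀ v, v ∈ M → v ∈ J → v = p) (hRJ : ∀ v, v ∈ R → v ∉ J)
    (hNM : ∀ v, v ∈ N → v ∈ M → v = x) (hNR : ∀ v, v ∈ N → v ∈ R → v = x)
    (hMR : ∀ v, v ∈ M → v ∈ R → v = x)
    (hSZ : ∀ v, v ∈ S → v ∈ Z → v = y) (hNZ : ∀ v, v ∈ N → v ∉ Z)
    (hMZ : ∀ v, v ∈ M → v ∈ Z → v = p) (hRZ : ∀ v, v ∈ R → v ∈ Z → v = y)
    (hJZ : ∀ v, v ∈ J → v ∈ Z → v = p) (hs : φ j + d = c + r + m) :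
    ∃ f k, G.Hub σ e (S ∪ N ∪ M ∪ R ∪ J) Z f k p y ∧ f p = n + m ∧ f y = n + r := by
  classical
  obtain ⟨ν, νt, νx, hν⟩ := hN.exists_partial_sums
  obtain ⟨μ, μx, μp, hμ⟩ := hM.exists_partial_sums
  obtain ⟨ρ, ρx, ρy, hρ⟩ := hR.exists_partial_sums
  obtain ⟨ψ, ψj, ψp, hψ⟩ := hJ.exists_partial_sums
  have htS := hty.left_mem
  have hyS := hty.right_mem
  have htne := hty.ne
  have hmem : t ∈ N ∧ x ∈ N ∧ x ∈ M ∧ p ∈ M ∧ x ∈ R ∧ y ∈ R ∧ j ∈ J ∧ p ∈ J :=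
    ⟨hN.left_mem, hN.right_mem, hM.left_mem, hM.right_mem, hR.left_mem, hR.right_mem,
      hJ.left_mem, hJ.right_mem⟩
  -- On `N`, `M` and `R` the potential measures labels from t. On `S` it is forced: with constant `c
  -- + n + r`, leaving through l and p must have label `φ l + n + m`. On `J` it continues from j
  -- and, by `hs`, agrees at p with the value from `M`.
  let f : V → ZMod 2 := fun v => if v = y then n + r else if v ∈ N then ν v else
    if v ∈ S then φ v + c + n + r else if v ∈ M then n + μ v else if v ∈ R then n + ρ v else
      φ j + c + n + r + ψ v
  have hfy : f y = n + r := if_pos rfl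
  have hfN : ∀ v, v ∈ N → f v = ν v := fun v hv => by
    have : v ≠ y := by grind
    simp [f, this, hv]
  have hfS : ∀ v, v ∈ S → v ≠ t → v ≠ y → f v = φ v + c + n + r := fun v hv h h' => by
    have : v ∉ N := by grind
    simp [f, this, hv, h']
  have hfM : ∀ v, v ∈ M → f v = n + μ v := fun v hv => by
    by_cases hvx : v = x
    · subst hvx
      rw [hfN v hN.right_mem, νx, μx, add_zero]
    · have h1 : v ∉ N := by grind
      have h2 : v ∉ S := by grind
      have h3 : v ≠ y := by grind
      simp [f, h1, h2, h3, hv]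
  have hfR : ∀ v, v ∈ R → f v = n + ρ v := fun v hv => by
    by_cases hvx : v = x
    · subst hvx
      rw [hfN v hN.right_mem, νx, ρx, add_zero]
    by_cases hvy : v = y
    · subst hvy
      rw [hfy, ρy]
    · have h1 : v ∉ N := by grind
      have h2 : v ∉ S := by grind
      have h3 : v ∉ M := by grind
      simp [f, h1, h2, h3, hv, hvy]
  have hfJ : ∀ v, v ∈ J → v ≠ j → v ≠ p → f v = φ j + c + n + r + ψ v := fun v hv h h' => by
    have h1 : v ∉ N := by grind
    have h2 : v ∉ S := by grind
    have h3 : v ∉ M := by grind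
    have h4 : v ∉ R := by grind
    have h5 : v ≠ y := by grind
    simp [f, h1, h2, h3, h4, h5]
  have hfp : f p = n + m := by rw [hfM p hM.right_mem, μp]
  have hNM' := hN.append hM hNM
  have hNR' := hN.append hR hNR
  have hjt' := hS j hj hjt hjy
  clear_value f
  refine ⟨f, c + n + r, ⟨?_, ?_, ?_⟩, hfp, hfy⟩
  · exact hty.extend_left hNM' (by grind) (by grind) (by grind) (by grind)
  · intro l hl hlp hly
    by_cases hlN : l ∈ N
    · obtain ⟨N₁, N₂, p₁, p₂, h1, h2⟩ := hν l hlN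
      clear hν hμ hρ hψ hS
      exact hjt'.symm.extend p₁ hJ (by grind) (by grind) (by grind) (by grind)
        (by grind) (by grind) (by grind)
    by_cases hlS : l ∈ S
    · have hlt : l ≠ t := by rintro rfl; exact hlN hmem.1
      have h1 := hfS l hlS hlt hly
      have h2 := hS l hlS hlt hly
      clear hν hμ hρ hψ hS
      exact h2.extend_right hNM' (by grind) (by grind) (by grind) (by grind)
    by_cases hlM : l ∈ M
    · obtain ⟨M₁, M₂, p₁, p₂, h1, h2⟩ := hμ l hlM
      clear hν hμ hρ hψ hS
      exact hjt'.symm.extend (hN.append p₁ (by grind)) hJ (by grind) (by grind) (by grind)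
        (by grind) (by grind) (by grind) (by grind)
    by_cases hlR : l ∈ R
    · obtain ⟨R₁, R₂, p₁, p₂, h1, h2⟩ := hρ l hlR
      clear hν hμ hρ hψ hS
      exact hjt'.symm.extend (hN.append p₁ (by grind)) hJ (by grind) (by grind) (by grind)
        (by grind) (by grind) (by grind) (by grind)
    · have hlJ : l ∈ J := by
        simp only [Set.mem_union] at hl
        tauto
      obtain ⟨J₁, J₂, p₁, p₂, h1, h2⟩ := hψ l hlJ
      have := hfJ l hlJ (fun h => hlS (h ▸ hj)) hlp
      clear hν hμ hρ hψ hS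
      exact hjt'.extend p₁ hNM' (by grind) (by grind) (by grind) (by grind)
        (by grind) (by grind) (by grind)
  · intro l hl hlp hly
    by_cases hlN : l ∈ N
    · obtain ⟨N₁, N₂, p₁, p₂, h1, h2⟩ := hν l hlN
      clear hν hμ hρ hψ hS
      exact hty.extend_left p₁ (by grind) (by grind) (by grind) (by grind)
    by_cases hlS : l ∈ S
    · have hlt : l ≠ t := by rintro rfl; exact hlN hmem.1
      have h1 := hfS l hlS hlt hly
      have h2 := hS l hlS hlt hly
      clear hν hμ hρ hψ hS
      exact h2.extend_right hNR' (by grind) (by grind) (by grind) (by grind)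
    by_cases hlM : l ∈ M
    · obtain ⟨M₁, M₂, p₁, p₂, h1, h2⟩ := hμ l hlM
      clear hν hμ hρ hψ hS
      exact hty.extend_left (hN.append p₁ (by grind)) (by grind) (by grind) (by grind) (by grind)
    by_cases hlR : l ∈ R
    · obtain ⟨R₁, R₂, p₁, p₂, h1, h2⟩ := hρ l hlR
      clear hν hμ hρ hψ hS
      exact hty.extend_left (hN.append p₁ (by grind)) (by grind) (by grind) (by grind) (by grind)
    · have hlJ : l ∈ J := by
        simp only [Set.mem_union] at hl
        tauto
      obtain ⟨J₁, J₂, p₁, p₂, h1, h2⟩ := hψ l hlJ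
      have := hfJ l hlJ (fun h => hlS (h ▸ hj)) hlp
      clear hν hμ hρ hψ hS
      exact hjt'.extend p₁ hNR' (by grind) (by grind) (by grind) (by grind)
        (by grind) (by grind) (by grind)

end SimpleGraph

namespace SimpleGraph

variable {V : Type*} {G : SimpleGraph V} {σ : Sym2 V → ZMod 2} {e e' : Sym2 V}

set_option maxHeartbeats 2000000 in
/-- Rungs with a common end `y`: the set `S` collects the part of the graph from which the path to
`t` can be reached without using `y`. -/
theorem bothParities_of_adjacent_rungs_aux [Finite V] (hG : G.IsVertexConnected 3)
    {S N M P Q R₁ R₂ : Set V} {c n m a b r₁ r₂ : ZMod 2} {t x₁ x₂ y w z : V}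
    (he' : s(w, z) = e') (hty : G.TwoPaths σ e S c t y)
    (hS : ∀ l, l ∈ S → l ≠ t → l ≠ y → ∃ s, G.TwoPaths σ e {v | v ∈ S ∧ v ≠ y} s l t)
    (hS' : ∃ l, l ∈ S ∧ l ≠ t ∧ l ≠ y)
    (hN : G.PathOn σ N n t x₁) (hM : G.PathOn σ M m x₁ x₂) (hP : G.PathOn σ P a x₂ w)
    (hQ : G.PathOn σ Q b y z) (hR₁ : G.PathOn σ R₁ r₁ x₁ y) (hR₂ : G.PathOn σ R₂ r₂ x₂ y)
    (hNS : ∀ v, v ∈ N → v ∈ S → v = t) (hMS : ∀ v, v ∈ M → v ∈ S → v = t)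
    (hPS : ∀ v, v ∈ P → v ∉ S) (hQS : ∀ v, v ∈ Q → v ∈ S → v = y)
    (hRS₁ : ∀ v, v ∈ R₁ → v ∈ S → v = t ∨ v = y) (hRS₂ : ∀ v, v ∈ R₂ → v ∈ S → v = y)
    (hNM : ∀ v, v ∈ N → v ∈ M → v = x₁) (hNP : ∀ v, v ∈ N → v ∉ P) (hNQ : ∀ v, v ∈ N → v ∉ Q)
    (hNR₁ : ∀ v, v ∈ N → v ∈ R₁ → v = x₁) (hNR₂ : ∀ v, v ∈ N → v ∉ R₂)
    (hMP : ∀ v, v ∈ M → v ∈ P → v = x₂) (hMQ : ∀ v, v ∈ M → v ∉ Q)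
    (hMR₁ : ∀ v, v ∈ M → v ∈ R₁ → v = x₁) (hMR₂ : ∀ v, v ∈ M → v ∈ R₂ → v = x₂)
    (hPQ : ∀ v, v ∈ P → v ∉ Q) (hPR₁ : ∀ v, v ∈ P → v ∉ R₁)
    (hPR₂ : ∀ v, v ∈ P → v ∈ R₂ → v = x₂) (hQR₁ : ∀ v, v ∈ Q → v ∈ R₁ → v = y)
    (hQR₂ : ∀ v, v ∈ Q → v ∈ R₂ → v = y) (hRR : ∀ v, v ∈ R₁ → v ∈ R₂ → v = y)
    (h₂ : ∃ l, l ∈ P ∪ Q ∪ R₂ ∧ l ≠ x₂ ∧ l ≠ y) (hs : r₁ + r₂ + m = 1) :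
    G.BothParities σ e e' := by
  induction hk : N.ncard using Nat.strong_induction_on generalizing S N n c t with
  | _ k ih =>
  subst he'
  have htS := hty.left_mem
  have hyS := hty.right_mem
  have htne := hty.ne
  obtain ⟨l, hl, hlt, hly⟩ := id hS'
  obtain ⟨J, d, j, p, hJ, htJ, hyJ, hjS, hpY, hJS, hJY⟩ := hG.exists_pathOn σ (X := S)
    (Y := N ∪ M ∪ P ∪ Q ∪ R₁ ∪ R₂) (x := l) (y := x₂) (p := t) (q := y) hl (by grind) hlt hly
    (by grind) (by grind)
  have hjt : j ≠ t := fun h => htJ (h ▸ hJ.left_mem)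
  have hjy : j ≠ y := fun h => hyJ (h ▸ hJ.left_mem)
  have hpt : p ≠ t := fun h => htJ (h ▸ hJ.right_mem)
  have hpy : p ≠ y := fun h => hyJ (h ▸ hJ.right_mem)
  simp only [Set.mem_union, or_imp, forall_and] at hJY
  obtain ⟨⟨⟨⟨⟨hJN, hJM⟩, hJP⟩, hJQ⟩, hJR₁⟩, hJR₂⟩ := hJY
  obtain ⟨s, hjt'⟩ := hS j hjS hjt hjy
  have hpS : p ∉ S := by grind
  by_cases hpN : p ∈ N
  -- `S` absorbs `J` and the beginning of `N`, and t advances to p. The labels of the new exits are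
  -- irrelevant, which is why `hS` asks only for some label.
  · obtain ⟨N₁, N₂, n₁, n₂, p₁, p₂, hN₁, hN₂, hN', hd, -⟩ := hN.split hpN
    refine ih _ ?_ (S := S ∪ N₁ ∪ J) (t := p)
      (hty.extend_left p₁ (by grind) (by grind) (by grind) rfl) ?_ ⟨t, by grind⟩ p₂
      (by grind) (by grind) (by grind) (by grind) (by grind) (by grind) (by grind) (by grind)
      (by grind) (by grind) (by grind) rfl
    · rw [← hk]
      exact PathOn.ncard_lt_of_split hN₂ hN.left_mem (by grind)
    · intro l hl hlp hly
      by_cases hlN : l ∈ N₁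
      · obtain ⟨A, B, a, b, q₁, q₂, hA, hB, hAB, hd', -⟩ := p₁.split hlN
        exact ⟨_, hjt'.symm.extend q₁ hJ (by grind) (by grind) (by grind) (by grind) (by grind)
          (by grind) rfl⟩
      by_cases hlS : l ∈ S
      · obtain ⟨s', hs'⟩ := hS l hlS (by grind) hly
        exact ⟨_, hs'.extend_right p₁ (by grind) (by grind) (by grind) rfl⟩
      · obtain ⟨A, B, a, b, q₁, q₂, hA, hB, hAB, hd', -⟩ := hJ.split (m := l) (by grind)
        exact ⟨_, hjt'.extend q₁ p₁ (by grind) (by grind) (by grind) (by grind) (by grind)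
          (by grind) rfl⟩
  clear ih
  have hB : G.TwoPaths σ s(w, z) (P ∪ Q) (a + b) x₂ y :=
    ⟨w, z, P, Q, a, b, rfl, hP.symm, hQ.symm, hPQ, by grind, by grind, rfl⟩
  have hNM' := hN.append hM hNM
  have hNR' := hN.append hR₁ hNR₁
  by_cases hpM : p ∈ M
  · obtain ⟨M₁, M₂, m₁, m₂, p₁, p₂, hM₁, hM₂, hM', hd, rfl⟩ := hM.split hpM
    -- Equality is the consistency condition under which `S` with the fork at `x₁` is a hub with
    -- frontier {p, y}. If it fails, leaving `S` through t, y and through j, t gives both parities.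
    by_cases hsj : s + d = c + r₁ + m₁
    · choose! φ hφ using hS
      classical
      -- A pair of exits may have several labels; the choice at j has to be the label s for which
      -- consistency was assumed.
      have hφ' : ∀ l, l ∈ S → l ≠ t → l ≠ y → G.TwoPaths σ e {v | v ∈ S ∧ v ≠ y}
          (Function.update φ j s l) l t := by
        intro l hl hlt hly
        by_cases hlj : l = j
        · subst hlj
          rwa [Function.update_self]
        · rw [Function.update_of_ne hlj]
          exact hφ l hl hlt hly
      obtain ⟨f, κ, hA, fp, fy⟩ := Hub.of_fork (Z := P ∪ Q ∪ R₂) hty hφ' hjS hjt hjy hN p₁ hR₁ hJ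
        (by grind) (by grind) (by grind) (by grind) (by grind) (by grind) (by grind) (by grind)
        (by grind) (by grind) (by grind) (by grind) (by grind) (by grind) (by grind)
        (by rwa [Function.update_self])
      obtain ⟨g, κ', hB, gx, gy⟩ := Hub.of_rung rfl hP.symm hQ.symm hR₂ (by grind) (by grind)
        (by grind)
      clear hS' hφ hφ' hty hjt'
      -- The two hubs already share y, so the second connecting path is trivial.
      refine hA.bothParities hG hB p₂ (PathOn.refl G σ y) (by grind) (by grind) (by grind)
        (by grind) (by grind) ?_ ⟨j, by grind⟩ h₂ ?_
      · clear h₂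
        grind
      · rw [zmod_two_ne_iff, fp, fy, gx, gy]
        grind
    · have l₁ := hty.linkage hB hNM' (PathOn.refl G σ y) (by grind) (by grind) (by grind)
        (by grind) (by grind) (by grind)
      have l₂ := hjt'.linkage hB (hJ.append p₂ (by grind)) hNR' (by grind) (by grind) (by grind)
        (by grind) (by grind) (by grind)
      refine BothParities.of_ne l₁ l₂ fun h => hsj ?_
      grind
  by_cases hpR₁ : p ∈ R₁
  · obtain ⟨A, B, a', b', p₁, p₂, hA, hB', hAB, hd, rfl⟩ := hR₁.split hpR₁
    obtain ⟨u, v, U, W, α, β, rfl, hU, hW, hUW, hUS, hWS, -⟩ := hjt'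
    have hUS' : ∀ v, v ∈ U → v ∈ S := fun v hv => (hUS v hv).1
    have hWS' : ∀ v, v ∈ W → v ∈ S := fun v hv => (hWS v hv).1
    have hUy : y ∉ U := fun h => (hUS y h).2 rfl
    have hWy : y ∉ W := fun h => (hWS y h).2 rfl
    clear hUS hWS hS hS' hty
    -- The part of `R₁` from p to y joins the linking path that arrives along `J`. What is left of
    -- `R₁` and `R₂` are disjoint parallel rungs on the same odd cycle.
    refine bothParities_of_parallel_rungs hG Sym2.eq_swap rfl (hW.append hN (by grind)) hM hP
      (hU.append hJ (by grind)) p₂ hQ p₁ hR₂ ?_ (by grind) (by grind) (by grind) (by grind)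
      (by grind) (by grind) (by grind) (by grind) (by grind) (by grind) (by grind)
      ⟨j, by grind, by grind, by grind⟩ h₂ (by grind)
    grind
  by_cases hpR₂ : p ∈ R₂
  · obtain ⟨A, B, a', b', p₁, p₂, hA, hB', hAB, hd, rfl⟩ := hR₂.split hpR₂
    -- In the remaining cases `S` is left through j and t, and the two linkages run around the odd
    -- cycle `R₁ ∪ M ∪ R₂` in its two ways.
    have l₁ := hjt'.linkage hB (hJ.append p₁.symm (by grind)) hNR' (by grind) (by grind) (by grind)
      (by grind) (by grind) (by grind)
    have l₂ := hjt'.linkage hB.symm (hJ.append p₂ (by grind)) hNM' (by grind) (by grind)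
      (by grind) (by grind) (by grind) (by grind)
    refine BothParities.of_ne l₁ l₂ ?_
    rw [zmod_two_ne_iff]
    grind
  have hNMR := hNM'.append hR₂ (by grind)
  have hNRR := hNR'.append hR₂.symm (by grind)
  by_cases hpP : p ∈ P
  · obtain ⟨A, B, a', b', p₁, p₂, hA, hB', hAB, hd, rfl⟩ := hP.split hpP
    have hB₁ : G.TwoPaths σ s(w, z) (B ∪ Q) (b' + b) p y :=
      ⟨w, z, B, Q, _, _, rfl, p₂.symm, hQ.symm, by grind, by grind, by grind, rfl⟩
    have l₁ := hjt'.linkage hB₁ hJ hNR' (by grind) (by grind) (by grind)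
      (by grind) (by grind) (by grind)
    have l₂ := hjt'.linkage hB₁ hJ hNMR (by grind) (by grind) (by grind)
      (by grind) (by grind) (by grind)
    refine BothParities.of_ne l₁ l₂ ?_
    rw [zmod_two_ne_iff]
    grind
  · obtain ⟨A, B, a', b', p₁, p₂, hA, hB', hAB, hd, rfl⟩ := hQ.split (m := p) (by grind)
    have hB₁ : G.TwoPaths σ s(w, z) (B ∪ P) (b' + a) p x₂ :=
      ⟨z, w, B, P, _, _, Sym2.eq_swap, p₂.symm, hP.symm, by grind, by grind, by grind, rfl⟩
    have l₁ := hjt'.linkage hB₁ hJ hNM' (by grind) (by grind) (by grind)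
      (by grind) (by grind) (by grind)
    have l₂ := hjt'.linkage hB₁ hJ hNRR (by grind) (by grind) (by grind)
      (by grind) (by grind) (by grind)
    refine BothParities.of_ne l₁ l₂ ?_
    rw [zmod_two_ne_iff]
    grind

end SimpleGraph

/-! ### Rungs with one common end, and the jump out of a double rung -/

namespace SimpleGraph

variable {V : Type*} {G : SimpleGraph V} {σ : Sym2 V → ZMod 2} {e e' : Sym2 V}

section

variable {P₁ M P₂ Q₁ Q₂ R₁ R₂ : Set V} {a₁ m a₂ b₁ b₂ r₁ r₂ : ZMod 2} {u v w z x₁ x₂ y : V}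

/-- Two rungs between two linking paths, with one common end. -/
theorem bothParities_of_adjacent_rungs [Finite V] (hG : G.IsVertexConnected 3)
    (he : s(u, v) = e) (he' : s(w, z) = e')
    (hP₁ : G.PathOn σ P₁ a₁ u x₁) (hM : G.PathOn σ M m x₁ x₂) (hP₂ : G.PathOn σ P₂ a₂ x₂ w)
    (hQ₁ : G.PathOn σ Q₁ b₁ v y) (hQ₂ : G.PathOn σ Q₂ b₂ y z)
    (hR₁ : G.PathOn σ R₁ r₁ x₁ y) (hR₂ : G.PathOn σ R₂ r₂ x₂ y)
    (hPQ : ∀ t, t ∈ P₁ ∪ M ∪ P₂ → t ∉ Q₁ ∪ Q₂)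
    (hPM : ∀ t, t ∈ P₁ → t ∈ M → t = x₁) (hMP : ∀ t, t ∈ M → t ∈ P₂ → t = x₂)
    (hPP : ∀ t, t ∈ P₁ → t ∉ P₂) (hQQ : ∀ t, t ∈ Q₁ → t ∈ Q₂ → t = y)
    (hRP₁ : ∀ t, t ∈ R₁ → t ∈ P₁ ∪ M ∪ P₂ → t = x₁)
    (hRQ₁ : ∀ t, t ∈ R₁ → t ∈ Q₁ ∪ Q₂ → t = y)
    (hRP₂ : ∀ t, t ∈ R₂ → t ∈ P₁ ∪ M ∪ P₂ → t = x₂)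
    (hRQ₂ : ∀ t, t ∈ R₂ → t ∈ Q₁ ∪ Q₂ → t = y)
    (hRR : ∀ t, t ∈ R₁ → t ∈ R₂ → t = y)
    (h₁ : ∃ t, t ∈ P₁ ∪ Q₁ ∪ R₁ ∧ t ≠ x₁ ∧ t ≠ y) (h₂ : ∃ t, t ∈ P₂ ∪ Q₂ ∪ R₂ ∧ t ≠ x₂ ∧ t ≠ y)
    (hy : v ≠ y ∨ z ≠ y) (hs : r₁ + r₂ + m = 1) : G.BothParities σ e e' := by
  -- Exchanging the two edges reverses the configuration. The end v different from y serves as the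
  -- first vertex from which `S` can be left.
  wlog hvy : v ≠ y generalizing P₁ P₂ Q₁ Q₂ R₁ R₂ a₁ a₂ b₁ b₂ r₁ r₂ u v w z x₁ x₂ e e'
  · refine (this he' he hP₂.symm hM.symm hP₁.symm hQ₂.symm hQ₁.symm hR₂ hR₁
      ?_ (fun t h h' => hMP t h' h) (fun t h h' => hPM t h' h) (fun t h h' => hPP t h' h)
      (fun t h h' => hQQ t h' h) ?_ ?_ ?_ ?_ (fun t h h' => hRR t h' h) h₂ h₁ hy.symm
      (by rw [add_comm r₂, hs]) (hy.resolve_left hvy)).symm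
    · intro t ht ht'
      exact hPQ t (by grind) (by grind)
    · exact fun t h h' => hRP₂ t h (by grind)
    · exact fun t h h' => hRQ₂ t h (by grind)
    · exact fun t h h' => hRP₁ t h (by grind)
    · exact fun t h h' => hRQ₁ t h (by grind)
  simp only [Set.mem_union, or_imp, forall_and, not_or] at hPQ hRP₁ hRQ₁ hRP₂ hRQ₂
  subst he
  clear h₁
  have huQ : u ∉ Q₁ := by grind
  -- The starting piece has t = u, so all of `P₁` is still to be traversed.
  refine bothParities_of_adjacent_rungs_aux hG (S := {u} ∪ Q₁) (c := b₁) he'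
    ⟨u, v, {u}, Q₁, 0, b₁, rfl, PathOn.refl G σ u, hQ₁, ?_, by grind, by grind, zero_add _⟩ ?_
    ⟨v, by grind⟩ hP₁ hM hP₂ hQ₂ hR₁ hR₂ ?_ ?_ ?_ ?_ ?_ ?_ ?_ ?_ ?_ ?_ ?_ ?_ ?_ ?_ ?_ ?_
    ?_ ?_ ?_ ?_ ?_ h₂ hs
  · rintro t rfl
    exact huQ
  · intro l hl hlu hly
    obtain ⟨A, B, a, b, p₁, p₂, hA, hB, hAB, hd, -⟩ := hQ₁.split (m := l) (by grind)
    exact ⟨_, v, u, A, {u}, a, 0, Sym2.eq_swap, p₁, PathOn.refl G σ u, by grind, by grind,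
      by grind, rfl⟩
  all_goals grind

end

/-- A path avoiding the edge `s(u, v)` has an inner vertex, unless its ends are not `u`, `v`. -/
theorem PathOn.exists_mem_of_deleteEdges {F : Set (Sym2 V)} {R P Q : Set V} {r : ZMod 2}
    {x y u v : V} (hR : (G.deleteEdges F).PathOn σ R r x y) (hF : s(u, v) ∈ F) (hxy : x ≠ y)
    (huy : u ≠ y) (hvx : v ≠ x) (hu : u ∈ P) (hv : v ∈ Q) :
    ∃ t, t ∈ P ∪ Q ∪ R ∧ t ≠ x ∧ t ≠ y := by
  by_cases hux : u = x
  · by_cases hvy : v = y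
    · by_contra! h
      have h1 := (hR.adj_of_subset_pair hxy fun t ht => by
        by_cases htx : t = x
        · exact .inl htx
        · exact .inr (h t (.inr ht) htx)).1
      rw [SimpleGraph.deleteEdges_adj] at h1
      exact h1.2 (hux ▸ hvy ▸ hF)
    · exact ⟨v, .inl (.inr hv), hvx, hvy⟩
  · exact ⟨u, .inl (.inl hu), hux, huy⟩

variable {P Q R₁ R₂ : Set V} {a b r₁ r₂ : ZMod 2} {u v w z x₁ x₂ y₁ y₂ x y : V}

set_option maxHeartbeats 1000000 in
/-- Two rungs between two linking paths, with both ends in common; one of them has an inner vertex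
that can be joined to the path `P`. -/
theorem bothParities_of_rungs_of_jump [Finite V] (hG : G.IsVertexConnected 3)
    (he : s(u, v) = e) (he' : s(w, z) = e') (hvz : v ≠ z)
    (hP : G.PathOn σ P a u w) (hQ : G.PathOn σ Q b v z) (hPQ : ∀ t, t ∈ P → t ∉ Q)
    (hR₁ : (G.deleteEdges {e, e'}).PathOn σ R₁ r₁ x y)
    (hR₂ : (G.deleteEdges {e, e'}).PathOn σ R₂ r₂ x y) (hx : x ∈ P) (hy : y ∈ Q)
    (hRP₁ : ∀ t, t ∈ R₁ → t ∈ P → t = x) (hRQ₁ : ∀ t, t ∈ R₁ → t ∈ Q → t = y)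
    (hRP₂ : ∀ t, t ∈ R₂ → t ∈ P → t = x) (hRQ₂ : ∀ t, t ∈ R₂ → t ∈ Q → t = y)
    (hRR : ∀ t, t ∈ R₁ → t ∈ R₂ → t = x ∨ t = y) (hs : r₁ + r₂ = 1)
    {J : Set V} {d : ZMod 2} {j p : V} (hJ : G.PathOn σ J d j p) (hj : j ∈ R₁) (hp : p ∈ P)
    (hxJ : x ∉ J) (hyJ : y ∉ J) (hJR₁ : ∀ t, t ∈ J → t ∈ R₁ → t = j)
    (hJR₂ : ∀ t, t ∈ J → t ∈ R₂ → t = j) (hJP : ∀ t, t ∈ J → t ∈ P → t = p)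
    (hJQ : ∀ t, t ∈ J → t ∈ Q → t = p) : G.BothParities σ e e' := by
  have hle : G.deleteEdges {e, e'} ≤ G := SimpleGraph.deleteEdges_le _
  have hjx : j ≠ x := by rintro rfl; exact hxJ hJ.left_mem
  have hjy : j ≠ y := by rintro rfl; exact hyJ hJ.left_mem
  have hpx : p ≠ x := by rintro rfl; exact hxJ hJ.right_mem
  have hpy : p ≠ y := by rintro rfl; exact hyJ hJ.right_mem
  have hjR₂ : j ∉ R₂ := fun h => by grind
  have hxy : x ≠ y := by grind
  have hu := hP.left_mem
  have hw := hP.right_mem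
  have hv := hQ.left_mem
  have hz := hQ.right_mem
  have huy : u ≠ y := by grind
  have hvx : v ≠ x := by grind
  have hwy : w ≠ y := by grind
  have hzx : z ≠ x := by grind
  obtain ⟨A, B, α, β, p₁, p₂, hA, hB, hAB, hd, rfl⟩ := (hR₁.mono hle).split hj
  obtain ⟨Q₁, Q₂, b₁, b₂, q₁, q₂, hQ₁, hQ₂, -, hQ₁₂, -⟩ := hQ.split hy
  have hyvz : v ≠ y ∨ z ≠ y := by grind
  obtain ⟨φ, hφ⟩ := hP.exists_cutPath
  -- P is rerouted between x and p through j: the part of `R₁` between x and j and the path `J`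
  -- replace the segment of P. The rest of `R₁` and `R₂` become rungs with common end y and distinct
  -- ends j and x.
  rcases hφ x p hx hp with ⟨U₁, U₂, U₃, c₁, c₂, c₃, h1, h2, h3, -, h4, h5, h6⟩ |
    ⟨U₁, U₂, U₃, c₁, c₂, c₃, h1, h2, h3, -, h4, h5, h6⟩
  · have k₁ := hR₂.exists_mem_of_deleteEdges (P := U₁) (Q := Q₁) (u := u) (v := v) (.inl he) hxy
      huy hvx c₁.left_mem q₁.left_mem
    clear hφ
    subst he he'
    refine bothParities_of_adjacent_rungs hG rfl rfl c₁ p₁ (hJ.append c₃ (by grind)) q₁ q₂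
      (hR₂.mono hle) p₂ ?_ (by grind) (by grind) (by grind) (by grind) (by grind)
      (by grind) ?_ (by grind) (by grind) k₁ ⟨p, by grind, by grind, by grind⟩ hyvz (by grind)
    all_goals clear k₁ hR₁ hR₂; grind
  · have k₂ := hR₂.exists_mem_of_deleteEdges (P := U₃) (Q := Q₂) (u := w) (v := z) (.inr he') hxy
      hwy hzx c₃.right_mem q₂.right_mem
    clear hφ
    subst he he'
    refine bothParities_of_adjacent_rungs hG rfl rfl (c₁.append hJ.symm (by grind)) p₁.symm c₃ q₁
      q₂ p₂ (hR₂.mono hle) ?_ (by grind) (by grind) (by grind) (by grind) ?_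
      (by grind) (by grind) (by grind) (by grind) ⟨p, by grind, by grind, by grind⟩ k₂ hyvz
      (by grind)
    all_goals clear k₂ hR₁ hR₂; grind

end SimpleGraph

/-! ### All positions of two rungs -/

namespace SimpleGraph

variable {V : Type*} {G : SimpleGraph V} {σ : Sym2 V → ZMod 2} {e e' : Sym2 V}
  {P Q R₁ R₂ : Set V} {a b r₁ r₂ : ZMod 2} {u v w z x₁ x₂ y₁ y₂ x y : V}

set_option maxHeartbeats 1000000 in
/-- Two rungs between two linking paths, with both ends in common. -/
theorem bothParities_of_double_rung [Finite V] (hG : G.IsVertexConnected 3)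
    (he : s(u, v) = e) (he' : s(w, z) = e') (huw : u ≠ w) (hvz : v ≠ z)
    (hP : G.PathOn σ P a u w) (hQ : G.PathOn σ Q b v z) (hPQ : ∀ t, t ∈ P → t ∉ Q)
    (hR₁ : (G.deleteEdges {e, e'}).PathOn σ R₁ r₁ x y)
    (hR₂ : (G.deleteEdges {e, e'}).PathOn σ R₂ r₂ x y) (hx : x ∈ P) (hy : y ∈ Q)
    (hRP₁ : ∀ t, t ∈ R₁ → t ∈ P → t = x) (hRQ₁ : ∀ t, t ∈ R₁ → t ∈ Q → t = y)
    (hRP₂ : ∀ t, t ∈ R₂ → t ∈ P → t = x) (hRQ₂ : ∀ t, t ∈ R₂ → t ∈ Q → t = y)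
    (hRR : ∀ t, t ∈ R₁ → t ∈ R₂ → t = x ∨ t = y) (hs : r₁ + r₂ = 1) :
    G.BothParities σ e e' := by
  have hxy : x ≠ y := by grind
  have hu := hP.left_mem
  have hw := hP.right_mem
  -- Two rungs without inner vertices would be the same edge, with label sum 0.
  obtain ⟨i, hi, hix, hiy⟩ : ∃ i, i ∈ R₁ ∪ R₂ ∧ i ≠ x ∧ i ≠ y := by
    by_contra! h
    simp only [Set.mem_union, or_imp, forall_and] at h
    have h₁ := (hR₁.adj_of_subset_pair hxy (by grind)).2
    have h₂ := (hR₂.adj_of_subset_pair hxy (by grind)).2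
    grind
  obtain ⟨o, ho, hox, hoy⟩ : ∃ o, o ∈ P ∪ Q ∧ o ≠ x ∧ o ≠ y := by
    by_cases h : u = x
    · exact ⟨w, .inl hw, by grind, by grind⟩
    · exact ⟨u, .inl hu, by grind, by grind⟩
  obtain ⟨J, d, j, p, hJ, hxJ, hyJ, hj, hp, hJR, hJP⟩ :=
    hG.exists_pathOn σ hi ho hix hiy hox hoy
  simp only [Set.mem_union, or_imp, forall_and] at hJR hJP
  have hRR' : ∀ t, t ∈ R₂ → t ∈ R₁ → t = x ∨ t = y := fun t h h' => hRR t h' h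
  have hs' : r₂ + r₁ = 1 := by rw [add_comm, hs]
  have hRR₃ : ∀ t, t ∈ R₁ → t ∈ R₂ → t = y ∨ t = x := fun t h h' => (hRR t h h').symm
  have hRR₄ : ∀ t, t ∈ R₂ → t ∈ R₁ → t = y ∨ t = x := fun t h h' => (hRR t h' h).symm
  have hQP : ∀ t, t ∈ Q → t ∉ P := fun t h h' => hPQ t h' h
  have f : s(v, u) = e := by rw [Sym2.eq_swap, he]
  have f' : s(z, w) = e' := by rw [Sym2.eq_swap, he']
  rcases hj with hj | hj <;> rcases hp with hp | hp
  · exact bothParities_of_rungs_of_jump hG he he' hvz hP hQ hPQ hR₁ hR₂ hx hy hRP₁ hRQ₁ hRP₂ hRQ₂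
      hRR hs hJ hj hp hxJ hyJ hJR.1 hJR.2 hJP.1 hJP.2
  · exact bothParities_of_rungs_of_jump hG f f' huw hQ hP hQP hR₁.symm hR₂.symm hy hx hRQ₁ hRP₁
      hRQ₂ hRP₂ hRR₃ hs hJ hj hp hyJ hxJ hJR.1 hJR.2 hJP.2 hJP.1
  · exact bothParities_of_rungs_of_jump hG he he' hvz hP hQ hPQ hR₂ hR₁ hx hy hRP₂ hRQ₂ hRP₁ hRQ₁
      hRR' hs' hJ hj hp hxJ hyJ hJR.2 hJR.1 hJP.1 hJP.2
  · exact bothParities_of_rungs_of_jump hG f f' huw hQ hP hQP hR₂.symm hR₁.symm hy hx hRQ₂ hRP₂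
      hRQ₁ hRP₁ hRR₄ hs' hJ hj hp hyJ hxJ hJR.2 hJR.1 hJP.2 hJP.1

variable {φ χ : V → ZMod 2}

set_option maxHeartbeats 1000000 in
/-- Two noncrossing rungs between two linking paths, possibly with common ends. -/
theorem bothParities_of_noncrossing_rungs [Finite V] (hG : G.IsVertexConnected 3)
    (he : s(u, v) = e) (he' : s(w, z) = e') (huw : u ≠ w) (hvz : v ≠ z)
    (hP : G.PathOn σ P a u w) (hQ : G.PathOn σ Q b v z) (hPQ : ∀ t, t ∈ P → t ∉ Q)
    (hφ : G.CutPath σ P φ a u x₁ x₂ w) (hχ : G.CutPath σ Q χ b v y₁ y₂ z)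
    (hR₁ : (G.deleteEdges {e, e'}).PathOn σ R₁ r₁ x₁ y₁)
    (hR₂ : (G.deleteEdges {e, e'}).PathOn σ R₂ r₂ x₂ y₂) (hx₁ : x₁ ∈ P) (hy₁ : y₁ ∈ Q)
    (hx₂ : x₂ ∈ P) (hy₂ : y₂ ∈ Q)
    (hRP₁ : ∀ t, t ∈ R₁ → t ∈ P → t = x₁) (hRQ₁ : ∀ t, t ∈ R₁ → t ∈ Q → t = y₁)
    (hRP₂ : ∀ t, t ∈ R₂ → t ∈ P → t = x₂) (hRQ₂ : ∀ t, t ∈ R₂ → t ∈ Q → t = y₂)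
    (hRR : ∀ t, t ∈ R₁ → t ∈ R₂ → t ∈ P ∨ t ∈ Q)
    (hs : r₁ + r₂ + (φ x₁ + φ x₂) + (χ y₁ + χ y₂) = 1) :
    G.BothParities σ e e' := by
  have hle : G.deleteEdges {e, e'} ≤ G := SimpleGraph.deleteEdges_le _
  obtain ⟨P₁, M₁, P₂, c₁, c₂, c₃, c₄, c₅, c₆, -, c₇, c₈, c₉⟩ := hφ
  obtain ⟨Q₁, M₂, Q₂, d₁, d₂, d₃, d₄, d₅, d₆, -, d₇, d₈, d₉⟩ := hχ
  have hu := hP.left_mem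
  have hw := hP.right_mem
  have hv := hQ.left_mem
  have hz := hQ.right_mem
  have hxy : x₁ ≠ y₁ := by grind
  have hxy' : x₂ ≠ y₂ := by grind
  -- Here the deletion of the two edges matters: a rung equal to e would leave the first piece no
  -- vertex besides `x₁` and `y₁`.
  have k₁ := hR₁.exists_mem_of_deleteEdges (P := P₁) (Q := Q₁) (u := u) (v := v) (.inl he) hxy
    (by grind) (by grind) c₁.left_mem d₁.left_mem
  have k₂ := hR₂.exists_mem_of_deleteEdges (P := P₂) (Q := Q₂) (u := w) (v := z) (.inr he') hxy'
    (by grind) (by grind) c₃.right_mem d₃.right_mem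
  by_cases hx : x₁ = x₂ <;> by_cases hy : y₁ = y₂
  · subst hx hy
    clear k₁ k₂
    exact bothParities_of_double_rung hG he he' huw hvz hP hQ hPQ hR₁ hR₂ hx₁ hy₁ hRP₁ hRQ₁ hRP₂
      hRQ₂ (by grind) (by grind)
  · subst hx
    have f : s(v, u) = e := by rw [Sym2.eq_swap, he]
    have f' : s(z, w) = e' := by rw [Sym2.eq_swap, he']
    have k₁' : ∃ t, t ∈ Q₁ ∪ P₁ ∪ R₁ ∧ t ≠ y₁ ∧ t ≠ x₁ := by
      obtain ⟨t, h, h', h''⟩ := k₁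
      exact ⟨t, by grind, h'', h'⟩
    have k₂' : ∃ t, t ∈ Q₂ ∪ P₂ ∪ R₂ ∧ t ≠ y₂ ∧ t ≠ x₁ := by
      obtain ⟨t, h, h', h''⟩ := k₂
      exact ⟨t, by grind, h'', h'⟩
    clear he he' k₁ k₂
    refine bothParities_of_adjacent_rungs hG f f' d₁ d₂ d₃ c₁ c₃ (hR₁.symm.mono hle)
      (hR₂.symm.mono hle) ?_ d₇ d₈ ?_ ?_ ?_ ?_ ?_ ?_ ?_ k₁' k₂' ?_ ?_
    all_goals clear k₁' k₂'; grind
  · subst hy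
    refine bothParities_of_adjacent_rungs hG he he' c₁ c₂ c₃ d₁ d₃ (hR₁.mono hle)
      (hR₂.mono hle) ?_ c₇ c₈ ?_ ?_ ?_ ?_ ?_ ?_ ?_ k₁ k₂ ?_ ?_
    all_goals clear k₁ k₂ he he'; grind
  · refine bothParities_of_parallel_rungs hG he he' c₁ c₂ c₃ d₁ d₂ d₃ (hR₁.mono hle)
      (hR₂.mono hle) ?_ c₇ c₈ ?_ d₇ d₈ ?_ ?_ ?_ ?_ ?_ ?_ k₁ k₂ ?_
    all_goals clear k₁ k₂ he he'; grind

/-- A cut at a single vertex can be read in both orders. -/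
theorem CutPath.swap_of_eq (h : G.CutPath σ P φ a u x₁ x₂ w) (hx : x₁ = x₂) :
    G.CutPath σ P φ a u x₂ x₁ w := by
  subst hx; exact h

set_option maxHeartbeats 1000000 in
/-- Two rungs between two linking paths. -/
theorem bothParities_of_rungs [Finite V] (hG : G.IsVertexConnected 3)
    (he : s(u, v) = e) (he' : s(w, z) = e') (huw : u ≠ w) (hvz : v ≠ z)
    (hP : G.PathOn σ P a u w) (hQ : G.PathOn σ Q b v z) (hPQ : ∀ t, t ∈ P → t ∉ Q)
    (hφ : G.CutPath σ P φ a u x₁ x₂ w ∨ G.CutPath σ P φ a u x₂ x₁ w)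
    (hχ : G.CutPath σ Q χ b v y₁ y₂ z ∨ G.CutPath σ Q χ b v y₂ y₁ z)
    (hR₁ : (G.deleteEdges {e, e'}).PathOn σ R₁ r₁ x₁ y₁)
    (hR₂ : (G.deleteEdges {e, e'}).PathOn σ R₂ r₂ x₂ y₂) (hx₁ : x₁ ∈ P) (hy₁ : y₁ ∈ Q)
    (hx₂ : x₂ ∈ P) (hy₂ : y₂ ∈ Q)
    (hRP₁ : ∀ t, t ∈ R₁ → t ∈ P → t = x₁) (hRQ₁ : ∀ t, t ∈ R₁ → t ∈ Q → t = y₁)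
    (hRP₂ : ∀ t, t ∈ R₂ → t ∈ P → t = x₂) (hRQ₂ : ∀ t, t ∈ R₂ → t ∈ Q → t = y₂)
    (hRR : ∀ t, t ∈ R₁ → t ∈ R₂ → t ∈ P ∨ t ∈ Q)
    (hs : r₁ + r₂ + (φ x₁ + φ x₂) + (χ y₁ + χ y₂) = 1) :
    G.BothParities σ e e' := by
  wlog hφ' : G.CutPath σ P φ a u x₁ x₂ w generalizing R₁ R₂ r₁ r₂ x₁ x₂ y₁ y₂
  · exact this hφ.symm hχ.symm hR₂ hR₁ hx₂ hy₂ hx₁ hy₁ hRP₂ hRQ₂ hRP₁ hRQ₁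
      (fun t h h' => hRR t h' h) (by rw [← hs]; ring) (hφ.resolve_left hφ')
  clear hφ
  rcases hχ with hχ | hχ
  · exact bothParities_of_noncrossing_rungs hG he he' huw hvz hP hQ hPQ hφ' hχ hR₁ hR₂ hx₁ hy₁ hx₂
      hy₂ hRP₁ hRQ₁ hRP₂ hRQ₂ hRR hs
  by_cases hy : y₁ = y₂
  · exact bothParities_of_noncrossing_rungs hG he he' huw hvz hP hQ hPQ hφ'
      (hχ.swap_of_eq hy.symm) hR₁ hR₂ hx₁ hy₁ hx₂ hy₂ hRP₁ hRQ₁ hRP₂ hRQ₂ hRR hs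
  by_cases hx : x₁ = x₂
  · exact bothParities_of_noncrossing_rungs hG he he' huw hvz hP hQ hPQ
      (hφ'.swap_of_eq hx) hχ hR₂ hR₁ hx₂ hy₂ hx₁ hy₁ hRP₂ hRQ₂ hRP₁ hRQ₁
      (fun t h h' => hRR t h' h) (by rw [← hs]; ring)
  obtain ⟨P₁, M₁, P₂, c₁, c₂, c₃, c₄, c₅, c₆, -, c₇, c₈, c₉⟩ := hφ'
  obtain ⟨Q₁, M₂, Q₂, d₁, d₂, d₃, d₄, d₅, d₆, -, d₇, d₈, d₉⟩ := hχ
  have hle : G.deleteEdges {e, e'} ≤ G := SimpleGraph.deleteEdges_le _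
  refine bothParities_of_crossing_rungs he he' c₁ c₂ c₃ d₁ d₂ d₃ (hR₁.mono hle)
    (hR₂.mono hle) ?_ c₇ c₈ ?_ d₇ d₈ ?_ ?_ ?_ ?_ ?_ ?_ ?_
  all_goals clear he he'; grind

end SimpleGraph

/-! ### Odd cycles and ears inconsistent with a potential -/

namespace SimpleGraph

variable {V : Type*} {G H : SimpleGraph V} {σ : Sym2 V → ZMod 2} {e e' : Sym2 V}

/-- The paths on `D₁` and `D₂` with common ends `x` and `y` form a cycle on `C`, and the labels on
that cycle sum up to `1`. -/
def OddArcs (G : SimpleGraph V) (σ : Sym2 V → ZMod 2) (C D₁ D₂ : Set V) (t : ZMod 2) (x y : V) :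
    Prop :=
  G.PathOn σ D₁ t x y ∧ G.PathOn σ D₂ (t + 1) x y ∧ (∀ v, v ∈ C ↔ v ∈ D₁ ∨ v ∈ D₂) ∧
    ∀ v, v ∈ D₁ → v ∈ D₂ → v = x ∨ v = y

/-- There is a cycle on `C` whose labels sum up to `1`. -/
def OddCycleOn (G : SimpleGraph V) (σ : Sym2 V → ZMod 2) (C : Set V) : Prop :=
  ∀ x y, x ∈ C → y ∈ C → x ≠ y → ∃ D₁ D₂ t, G.OddArcs σ C D₁ D₂ t x y

/-- Rotate the cycle to start at x and cut it at y; total label 1 makes the labels of the two arcs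
differ. -/
theorem Walk.IsCycle.oddCycleOn {v : V} {C : G.Walk v v} (hC : C.IsCycle)
    (hs : (C.edges.map σ).sum = 1) : G.OddCycleOn σ {t | t ∈ C.support} := by
  classical
  intro x y hx hy hxy
  simp only [Set.mem_ofPred_eq] at hx hy
  have hC' := hC.rotate hx
  have hmem : ∀ t, t ∈ (C.rotate x hx).support ↔ t ∈ C.support := fun t =>
    Walk.mem_support_rotate_iff ..
  have hs' : ((C.rotate x hx).edges.map σ).sum = 1 := by
    rw [← hs]
    exact ((C.rotate_edges x hx).perm.map σ).sum_eq
  generalize C.rotate x hx = c at *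
  have hyc : y ∈ c.support := (hmem y).2 hy
  have hspec := c.take_spec hyc
  have hp := hC'.isPath_takeUntil hyc
  have hq : (c.dropUntil y hyc).IsPath := by
    rw [← hspec] at hC'
    exact hC'.isPath_of_append_right (by simpa using hxy)
  have hn := hC'.support_nodup
  rw [← hspec, Walk.tail_support_append, List.nodup_append'] at hn
  rw [← hspec, Walk.edges_append, List.map_append, List.sum_append] at hs'
  refine ⟨{t | t ∈ (c.takeUntil y hyc).support}, {t | t ∈ (c.dropUntil y hyc).support}, _,
    ⟨_, hp, fun _ => Iff.rfl, rfl⟩,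
    PathOn.symm ⟨_, hq, fun _ => Iff.rfl, by grind⟩, fun t => ?_, fun t h h' => ?_⟩
  · simp only [Set.mem_ofPred_eq]
    rw [← hmem, ← Walk.mem_support_append_iff, hspec]
  · simp only [Set.mem_ofPred_eq] at h h'
    rw [← Walk.cons_tail_support, List.mem_cons] at h h'
    by_contra! hne
    exact hn.2.2 (h.resolve_left hne.1) (h'.resolve_left hne.2)

/-- An arc with ends in `S` which is inconsistent with the potential `h` contains such an arc with
no inner vertex in `S`. -/
theorem OddArcs.exists_ear [Finite V] {C S D₁ D₂ : Set V} {t : ZMod 2} {x y : V}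
    (hD : G.OddArcs σ C D₁ D₂ t x y) (h : V → ZMod 2) (hx : x ∈ S) (hy : y ∈ S) (hxy : x ≠ y)
    (ht : t = h x + h y + 1) :
    ∃ E D t' x' y', G.OddArcs σ C E D t' x' y' ∧ x' ∈ S ∧ y' ∈ S ∧ x' ≠ y' ∧
      t' = h x' + h y' + 1 ∧ (∀ v, v ∈ E → v ∈ D₁) ∧ ∀ v, v ∈ E → v ∈ S → v = x' ∨ v = y' := by
  induction hn : D₁.ncard using Nat.strong_induction_on generalizing D₁ D₂ t x y with
  | _ n ih =>
  by_cases hS : ∀ v, v ∈ D₁ → v ∈ S → v = x ∨ v = y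
  · exact ⟨D₁, D₂, t, x, y, hD, hx, hy, hxy, ht, fun _ h => h, hS⟩
  push Not at hS
  obtain ⟨m, hm, hmS, hmx, hmy⟩ := hS
  obtain ⟨h₁, h₂, hC, hd⟩ := hD
  obtain ⟨A, B, α, β, p₁, p₂, hA, hB, hAB, hABd, rfl⟩ := h₁.split hm
  have hyA : y ∉ A := by grind
  have hxB : x ∉ B := by grind
  -- The discrepancies of the two halves add up to 1, so exactly one half is inconsistent; the other
  -- half is moved to the complementary arc.
  by_cases hα : α = h x + h m + 1
  · obtain ⟨E, D, t', x', y', k₁, k₂, k₃, k₄, k₅, k₆, k₇⟩ :=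
      ih A.ncard (hn ▸ PathOn.ncard_lt_of_split hA h₁.right_mem hyA) (D₂ := D₂ ∪ B)
        ⟨p₁, by convert h₂.append p₂.symm (by grind) using 1; grind, by grind, by grind⟩
        hx hmS hmx.symm hα rfl
    exact ⟨E, D, t', x', y', k₁, k₂, k₃, k₄, k₅, fun v hv => hA v (k₆ v hv), k₇⟩
  · have hβ : β = h m + h y + 1 := by
      rw [← Ne, zmod_two_ne_iff] at hα; grind
    obtain ⟨E, D, t', x', y', k₁, k₂, k₃, k₄, k₅, k₆, k₇⟩ :=
      ih B.ncard (hn ▸ PathOn.ncard_lt_of_split hB h₁.left_mem hxB) (D₂ := A ∪ D₂)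
        ⟨p₂, by convert p₁.symm.append h₂ (by grind) using 1; grind, by grind, by grind⟩
        hmS hy hmy hβ rfl
    exact ⟨E, D, t', x', y', k₁, k₂, k₃, k₄, k₅, fun v hv => hB v (k₆ v hv), k₇⟩

variable {P Q E : Set V} {a b r : ZMod 2} {u v w z x y : V} {φ : V → ZMod 2}

/-- Rerouting a linking path through an inconsistent ear changes the parity. -/
theorem bothParities_of_ear (he : s(u, v) = e) (he' : s(w, z) = e')
    (hP : G.PathOn σ P a u w) (hQ : G.PathOn σ Q b v z) (hPQ : ∀ t, t ∈ P → t ∉ Q)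
    (hφ : G.CutPath σ P φ a u x y w ∨ G.CutPath σ P φ a u y x w) (hE : G.PathOn σ E r x y)
    (hxy : x ≠ y) (hEP : ∀ t, t ∈ E → t ∈ P → t = x ∨ t = y) (hEQ : ∀ t, t ∈ E → t ∉ Q)
    (hr : r = φ x + φ y + 1) : G.BothParities σ e e' := by
  wlog hφ' : G.CutPath σ P φ a u x y w generalizing x y
  · exact this hφ.symm hE.symm hxy.symm (fun t h h' => (hEP t h h').symm)
      (by rw [hr, add_comm (φ x)]) (hφ.resolve_left hφ')
  obtain ⟨P₁, M₁, P₂, c₁, c₂, c₃, c₄, c₅, c₆, -, c₇, c₈, c₉⟩ := hφ'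
  clear hφ
  refine BothParities.of_ne ⟨u, v, w, z, P, Q, a, b, he, he', hP, hQ, hPQ, rfl⟩
    ⟨u, v, w, z, P₁ ∪ E ∪ P₂, Q, _, b, he, he', (c₁.append hE ?_).append c₃ ?_, hQ, ?_, rfl⟩ ?_
  · clear he he'; grind
  · clear he he'; grind
  · clear he he'; grind
  · rw [zmod_two_ne_iff]
    grind

set_option maxHeartbeats 1000000 in
/-- An odd cycle that meets the paths of a linkage in at least two vertices. -/
theorem OddCycleOn.bothParities_of_linkage [Finite V] (hG : G.IsVertexConnected 3)
    {C : Set V} (hC : (G.deleteEdges {e, e'}).OddCycleOn σ C)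
    (he : s(u, v) = e) (he' : s(w, z) = e') (huw : u ≠ w) (hvz : v ≠ z)
    (hP : G.PathOn σ P a u w) (hQ : G.PathOn σ Q b v z) (hPQ : ∀ t, t ∈ P → t ∉ Q)
    (hx : x ∈ C) (hy : y ∈ C) (hxy : x ≠ y) (hxS : x ∈ P ∪ Q) (hyS : y ∈ P ∪ Q) :
    G.BothParities σ e e' := by
  classical
  have hle : G.deleteEdges {e, e'} ≤ G := SimpleGraph.deleteEdges_le _
  obtain ⟨φ, hφ⟩ := hP.exists_cutPath
  obtain ⟨χ, hχ⟩ := hQ.exists_cutPath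
  have hQP : ∀ t, t ∈ Q → t ∉ P := fun t h h' => hPQ t h' h
  have f : s(v, u) = e := by rw [Sym2.eq_swap, he]
  have f' : s(z, w) = e' := by rw [Sym2.eq_swap, he']
  -- The shift `ε` of the potential on `Q` cancels for ears with both ends on one linking path. Such
  -- inconsistent ears already give both parities, so any other inconsistent ear is a rung.
  have ear : ∀ {E r x y}, (G.deleteEdges {e, e'}).PathOn σ E r x y → x ∈ P ∪ Q → y ∈ P ∪ Q →
      x ≠ y → (∀ t, t ∈ E → t ∈ P ∪ Q → t = x ∨ t = y) → ∀ ε : ZMod 2,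
      r = (if x ∈ P then φ x else χ x + ε) + (if y ∈ P then φ y else χ y + ε) + 1 →
      ¬ G.BothParities σ e e' → ∃ x' y', x' ∈ P ∧ y' ∈ Q ∧
        (G.deleteEdges {e, e'}).PathOn σ E r x' y' ∧ (∀ t, t ∈ E → t ∈ P → t = x') ∧
        (∀ t, t ∈ E → t ∈ Q → t = y') ∧ r = φ x' + χ y' + ε + 1 := by
    intro E r x y hE hx hy hxy hES ε hr hB
    simp only [Set.mem_union, or_imp, forall_and] at hES
    by_cases hxP : x ∈ P <;> by_cases hyP : y ∈ P
    · exact absurd (bothParities_of_ear he he' hP hQ hPQ (hφ x y hxP hyP) (hE.mono hle) hxy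
        hES.1 (by clear he he' f f' hφ hχ; grind) (by simpa [hxP, hyP] using hr)) hB
    · clear he he' f f' hφ hχ
      exact ⟨x, y, hxP, by grind, hE, by grind, by grind, by grind⟩
    · clear he he' f f' hφ hχ
      exact ⟨y, x, hyP, by grind, hE.symm, by grind, by grind, by grind⟩
    · have hxQ : x ∈ Q := by grind
      have hyQ : y ∈ Q := by grind
      exact absurd (bothParities_of_ear f f' hQ hP hQP (hχ x y hxQ hyQ) (hE.mono hle) hxy
        hES.2 (by clear he he' f f' hφ hχ; grind) (by rw [hr]; grind)) hB
  by_contra hB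
  obtain ⟨D₁, D₂, t, hD⟩ := hC x y hx hy hxy
  -- The arcs have different labels, so exactly one of them is inconsistent; it is taken as `D₁`.
  obtain ⟨D₁, D₂, t, hD, ht⟩ : ∃ D₁ D₂ t, (G.deleteEdges {e, e'}).OddArcs σ C D₁ D₂ t x y ∧
      t = (if x ∈ P then φ x else χ x + 0) + (if y ∈ P then φ y else χ y + 0) + 1 := by
    by_cases ht : t = (if x ∈ P then φ x else χ x + 0) + (if y ∈ P then φ y else χ y + 0) + 1
    · exact ⟨D₁, D₂, t, hD, ht⟩
    · rw [← Ne, zmod_two_ne_iff] at ht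
      obtain ⟨h₁, h₂, hC, hd⟩ := hD
      refine ⟨D₂, D₁, t + 1, ⟨h₂, by convert h₁ using 1; grind, by grind, by grind⟩, by grind⟩
  obtain ⟨E₁, D, t₁, x₁, y₁, hD, hx₁, hy₁, hxy₁, ht₁, -, hE₁⟩ :=
    hD.exists_ear (fun t => if t ∈ P then φ t else χ t + 0) hxS hyS hxy ht
  obtain ⟨x₁', y₁', hx₁', hy₁', hE₁', hEP₁, hEQ₁, hr₁⟩ := ear hD.1 hx₁ hy₁ hxy₁ hE₁ 0 ht₁ hB
  obtain ⟨h₁, h₂, hDC, hd⟩ := hD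
  have hpq : (x₁ = x₁' ∧ y₁ = y₁') ∨ (x₁ = y₁' ∧ y₁ = x₁') := by
    have := h₁.left_mem
    have := h₁.right_mem
    clear he he' f f' hφ hχ ear h₁ h₂ hE₁'
    grind
  -- The ends of the first rung lie on different linking paths, so passing from `ε = 0` to `ε = 1`
  -- changes the required label by 1, just as passing to the complementary arc `D` does. Hence `D`
  -- is inconsistent with the shifted potential.
  obtain ⟨E₂, D', t₂, x₂, y₂, hD', hx₂, hy₂, hxy₂, ht₂, hED, hE₂⟩ :=
    OddArcs.exists_ear (S := P ∪ Q) (D₁ := D) (D₂ := E₁) (C := C) (t := t₁ + 1)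
      ⟨h₂, by convert h₁ using 1; grind, by grind, by grind⟩
      (fun t => if t ∈ P then φ t else χ t + 1) hx₁ hy₁ hxy₁
      (by have := hQP y₁' hy₁'; clear he he' f f' hφ hχ ear h₁ h₂ hE₁'; grind)
  obtain ⟨x₂', y₂', hx₂', hy₂', hE₂', hEP₂, hEQ₂, hr₂⟩ := ear hD'.1 hx₂ hy₂ hxy₂ hE₂ 1 ht₂ hB
  refine hB (bothParities_of_rungs hG he he' huw hvz hP hQ hPQ (hφ x₁' x₂' hx₁' hx₂')
    (hχ y₁' y₂' hy₁' hy₂') hE₁' hE₂' hx₁' hy₁' hx₂' hy₂' hEP₁ hEQ₁ hEP₂ hEQ₂ ?_ ?_)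
  · clear he he' f f' hφ hχ ear h₁ h₂ hE₁'; grind
  · clear he he' f f' hφ hχ ear h₁ h₂ hE₁'; grind

end SimpleGraph

/-! ### Rerouting a linkage through a cycle -/

namespace SimpleGraph

variable {V : Type*} {G : SimpleGraph V} {σ : Sym2 V → ZMod 2} {e e' : Sym2 V}
  {C P Q E T₁ T₂ : Set V} {a b r t₁ t₂ : ZMod 2} {u v w z x y x₀ y₀ z₁ z₂ : V}

/-- Rerouting a path through an ear. -/
theorem PathOn.exists_reroute (hP : G.PathOn σ P a u w) (hE : G.PathOn σ E r x y) (hx : x ∈ P)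
    (hy : y ∈ P) (hxy : x ≠ y) (hEP : ∀ t, t ∈ E → t ∈ P → t = x ∨ t = y) :
    ∃ P' a', G.PathOn σ P' a' u w ∧ (∀ t, t ∈ P' → t ∈ P ∨ t ∈ E) ∧ ∀ t, t ∈ E → t ∈ P' := by
  obtain ⟨φ, hφ⟩ := hP.exists_cutPath
  wlog hφ' : G.CutPath σ P φ a u x y w generalizing x y
  · exact this hE.symm hy hx hxy.symm (fun t h h' => (hEP t h h').symm)
      ((hφ x y hx hy).resolve_left hφ')
  obtain ⟨P₁, M₁, P₂, c₁, c₂, c₃, c₄, c₅, c₆, -, c₇, c₈, c₉⟩ := hφ'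
  clear hφ
  exact ⟨P₁ ∪ E ∪ P₂, _, (c₁.append hE (by grind)).append c₃ (by grind), by grind, by grind⟩

/-- There are two disjoint paths linking `e` and `e'` that together contain two vertices of `C`. -/
def LinkageMeetsTwice (G : SimpleGraph V) (σ : Sym2 V → ZMod 2) (e e' : Sym2 V) (C : Set V) :
    Prop :=
  ∃ u v w z P Q a b x y, s(u, v) = e ∧ s(w, z) = e' ∧ G.PathOn σ P a u w ∧ G.PathOn σ Q b v z ∧
    (∀ t, t ∈ P → t ∉ Q) ∧ x ∈ C ∧ y ∈ C ∧ x ≠ y ∧ x ∈ P ∪ Q ∧ y ∈ P ∪ Q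

theorem LinkageMeetsTwice.of_ear (he : s(u, v) = e) (he' : s(w, z) = e')
    (hP : G.PathOn σ P a u w) (hQ : G.PathOn σ Q b v z) (hPQ : ∀ t, t ∈ P → t ∉ Q)
    (hE : G.PathOn σ E r z₁ z₂) (hz₁ : z₁ ∈ P) (hz₂ : z₂ ∈ P) (hz : z₁ ≠ z₂)
    (hEP : ∀ t, t ∈ E → t ∈ P → t = z₁ ∨ t = z₂) (hEQ : ∀ t, t ∈ E → t ∉ Q)
    (hx : x ∈ C) (hy : y ∈ C) (hxy : x ≠ y) (hxE : x ∈ E) (hyE : y ∈ E) :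
    G.LinkageMeetsTwice σ e e' C := by
  obtain ⟨P', a', hP', h₁, h₂⟩ := hP.exists_reroute hE hz₁ hz₂ hz hEP
  exact ⟨u, v, w, z, P', Q, a', b, x, y, he, he', hP', hQ,
    fun t h => (h₁ t h).elim (hPQ t) (hEQ t), hx, hy, hxy, .inl (h₂ x hxE), .inl (h₂ y hyE)⟩

set_option maxHeartbeats 2000000 in
/-- Two disjoint paths from a cycle to the two paths of a linkage can be used to reroute the
linkage through the cycle. -/
theorem OddCycleOn.linkageMeetsTwice_of_tails [Finite V] (hG : G.IsVertexConnected 3)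
    (hC : G.OddCycleOn σ C) (he : s(u, v) = e) (he' : s(w, z) = e') (huw : u ≠ w) (hvz : v ≠ z)
    (hP : G.PathOn σ P a u w) (hQ : G.PathOn σ Q b v z) (hPQ : ∀ t, t ∈ P → t ∉ Q)
    (hT₁ : G.PathOn σ T₁ t₁ x₀ z₁) (hT₂ : G.PathOn σ T₂ t₂ y₀ z₂) (hTT : ∀ t, t ∈ T₁ → t ∉ T₂)
    (hx₀ : x₀ ∈ C) (hy₀ : y₀ ∈ C) (hz₁ : z₁ ∈ P) (hz₂ : z₂ ∈ Q)
    (hTC₁ : ∀ t, t ∈ T₁ → t ∈ C → t = x₀) (hTC₂ : ∀ t, t ∈ T₂ → t ∈ C → t = y₀)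
    (hTP₁ : ∀ t, t ∈ T₁ → t ∈ P → t = z₁) (hTQ₁ : ∀ t, t ∈ T₁ → t ∉ Q)
    (hTQ₂ : ∀ t, t ∈ T₂ → t ∈ Q → t = z₂) (hTP₂ : ∀ t, t ∈ T₂ → t ∉ P)
    (hCP : ∀ t, t ∈ C → t ∈ P → t = z₁) (hCQ : ∀ t, t ∈ C → t ∈ Q → t = z₂) :
    G.LinkageMeetsTwice σ e e' C := by
  induction hn : T₁.ncard + T₂.ncard using Nat.strong_induction_on
    generalizing P Q T₁ T₂ a b t₁ t₂ u v w z x₀ y₀ z₁ z₂ with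
  | _ n ih =>
  have hx₀T := hT₁.left_mem
  have hz₁T := hT₁.right_mem
  have hy₀T := hT₂.left_mem
  have hz₂T := hT₂.right_mem
  have hu := hP.left_mem
  have hw := hP.right_mem
  have hxy : x₀ ≠ y₀ := by rintro rfl; exact hTT _ hx₀T hy₀T
  have hzz : z₁ ≠ z₂ := by rintro rfl; exact hTT _ hz₁T hz₂T
  by_cases htriv : x₀ = z₁ ∧ y₀ = z₂
  · obtain ⟨rfl, rfl⟩ := htriv
    exact ⟨u, v, w, z, P, Q, a, b, x₀, y₀, he, he', hP, hQ, hPQ, hx₀, hy₀, hxy, .inl hz₁, .inr hz₂⟩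
  obtain ⟨i, hi, hi₁, hi₂⟩ : ∃ i, i ∈ C ∪ T₁ ∪ T₂ ∧ i ≠ z₁ ∧ i ≠ z₂ := by
    clear ih he he'
    by_cases h : x₀ = z₁
    · exact ⟨y₀, by grind, by grind, by grind⟩
    · exact ⟨x₀, by grind, by grind, by grind⟩
  obtain ⟨o, ho, ho₁, ho₂⟩ : ∃ o, o ∈ P ∪ Q ∧ o ≠ z₁ ∧ o ≠ z₂ := by
    clear ih he he'
    by_cases h : u = z₁
    · exact ⟨w, .inl hw, by grind, by grind⟩
    · exact ⟨u, .inl hu, by grind, by grind⟩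
  obtain ⟨J, d, j, p, hJ, hJ₁, hJ₂, hj, hp, hJX, hJS⟩ :=
    hG.exists_pathOn σ hi ho hi₁ hi₂ ho₁ ho₂
  clear hi ho hi₁ hi₂ ho₁ ho₂
  simp only [Set.mem_union, or_imp, forall_and] at hJX hJS
  obtain ⟨⟨hJC, hJT₁⟩, hJT₂⟩ := hJX
  obtain ⟨hJP, hJQ⟩ := hJS
  wlog hpP : p ∈ P generalizing P Q T₁ T₂ a b t₁ t₂ u v w z x₀ y₀ z₁ z₂
  · have hpQ := hp.resolve_left hpP
    refine this (by rw [Sym2.eq_swap, he]) (by rw [Sym2.eq_swap, he']) hvz huw hQ hP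
      (fun t h h' => hPQ t h' h) hT₂ hT₁ (fun t h h' => hTT t h' h) hy₀ hx₀ hz₂ hz₁ hTC₂ hTC₁
      hTQ₂ hTP₂ hTP₁ hTQ₁ hCQ hCP (by rw [add_comm, hn]) hy₀T hz₂T hx₀T hz₁T hQ.left_mem
      hQ.right_mem hxy.symm hzz.symm (fun h => htriv h.symm) hJ₂ hJ₁ ?_ hp.symm hJT₁ hJT₂ hJQ
      hJP hpQ
    rcases hj with (h | h) | h
    · exact .inl (.inl h)
    · exact .inr h
    · exact .inl (.inr h)
  have hjz₁ : j ≠ z₁ := by rintro rfl; exact hJ₁ hJ.left_mem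
  have hjz₂ : j ≠ z₂ := by rintro rfl; exact hJ₂ hJ.left_mem
  have hpz₁ : z₁ ≠ p := by rintro rfl; exact hJ₁ hJ.right_mem
  have hpJ := hJ.right_mem
  have hJQ' : ∀ t, t ∈ J → t ∉ Q := fun t h h' => hPQ p hpP (hJQ t h h' ▸ h')
  by_cases hjT₁ : j ∈ T₁
  · obtain ⟨A, B, α, β, p₁, p₂, hA, hB, hAB, hd, -⟩ := hT₁.split hjT₁
    have hzA : z₁ ∉ A := fun h => hjz₁ (hd z₁ h p₂.right_mem).symm
    have hA₀ := p₁.left_mem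
    have hAj := p₁.right_mem
    have hlt := PathOn.ncard_lt_of_split hA hz₁T hzA
    -- P is rerouted from `z₁` back along the first tail to j and then along `J`. The new path
    -- contains j, so the tail now ends there and is shorter.
    obtain ⟨P', a', hP', k₁, k₂⟩ := hP.exists_reroute (p₂.symm.append hJ fun t h h' =>
      hJT₁ t h' (hB t h)) hz₁ hpP hpz₁ (by clear ih he he'; grind)
    simp only [Set.mem_union] at k₁ k₂
    refine ih _ (by omega) he he' huw hvz hP' hQ ?_ p₁ hT₂ ?_ hx₀ hy₀
      (k₂ j (.inr hJ.left_mem)) hz₂ ?_ hTC₂ ?_ ?_ hTQ₂ ?_ ?_ hCQ rfl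
    all_goals clear ih he he'; grind
  clear ih hn hp
  by_cases hjT₂ : j ∈ T₂
  · obtain ⟨A, B, α, β, p₁, p₂, hA, hB, hAB, hd, -⟩ := hT₂.split hjT₂
    have hzA : z₂ ∉ A := fun h => hjz₂ (hd z₂ h p₂.right_mem).symm
    obtain ⟨D₁, D₂, t, hD₁, hD₂, hDC, -⟩ := hC x₀ y₀ hx₀ hy₀ hxy
    have hDC' : ∀ t, t ∈ D₁ → t ∈ C := fun t h => (hDC t).2 (.inl h)
    have hA₀ := p₁.left_mem
    clear hC hD₂ hDC
    -- The ear runs along the first tail to C, through an arc of C to `y₀`, along the second tail to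
    -- j, and along `J` back to P.
    refine .of_ear he he' hP hQ hPQ (((hT₁.symm.append hD₁ ?_).append p₁ ?_).append hJ ?_) hz₁ hpP
      hpz₁ ?_ ?_ hx₀ hy₀ hxy (.inl (.inl (.inl hx₀T))) (.inl (.inr hA₀))
    all_goals clear he he'; grind
  · have hjC : j ∈ C := by clear hC he he'; grind
    have hjx : x₀ ≠ j := by rintro rfl; exact hjT₁ hx₀T
    have hjy : y₀ ≠ j := by rintro rfl; exact hjT₂ hy₀T
    -- The only possible common vertex of C and Q is `y₀`, so an arc avoiding it stays off Q.
    obtain ⟨D, t, hD, hDC, hyD⟩ : ∃ D t, G.PathOn σ D t x₀ j ∧ (∀ t, t ∈ D → t ∈ C) ∧ y₀ ∉ D := by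
      obtain ⟨D₁, D₂, t, hD₁, hD₂, hDC, hDD⟩ := hC x₀ j hx₀ hjC hjx
      by_cases h : y₀ ∈ D₁
      · exact ⟨D₂, _, hD₂, fun t h => (hDC t).2 (.inr h), fun h' => by
          rcases hDD y₀ h h' with h | h
          · exact hxy h.symm
          · exact hjy h⟩
      · exact ⟨D₁, _, hD₁, fun t h => (hDC t).2 (.inl h), h⟩
    clear hC
    have hjD := hD.right_mem
    refine .of_ear he he' hP hQ hPQ ((hT₁.symm.append hD ?_).append hJ ?_) hz₁ hpP
      hpz₁ ?_ ?_ hx₀ hjC hjx (.inl (.inl hx₀T)) (.inl (.inr hjD))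
    all_goals clear he he'; grind

-- It may be assumed that C has at most one vertex on the linkage. If both tails end on the same
-- linking path, they form an ear together with an arc of C that avoids the possible extra vertex.
-- If they end on different paths, an extra vertex of C on the linkage serves as a trivial tail in
-- place of the tail to its path, which gives the hypotheses of `linkageMeetsTwice_of_tails`.
set_option maxHeartbeats 1000000 in
theorem OddCycleOn.linkageMeetsTwice_of_disjoint_tails [Finite V] (hG : G.IsVertexConnected 3)
    (hC : G.OddCycleOn σ C) (he : s(u, v) = e) (he' : s(w, z) = e') (huw : u ≠ w) (hvz : v ≠ z)
    (hP : G.PathOn σ P a u w) (hQ : G.PathOn σ Q b v z) (hPQ : ∀ t, t ∈ P → t ∉ Q)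
    (hT₁ : G.PathOn σ T₁ t₁ x₀ z₁) (hT₂ : G.PathOn σ T₂ t₂ y₀ z₂) (hTT : ∀ t, t ∈ T₁ → t ∉ T₂)
    (hx₀ : x₀ ∈ C) (hy₀ : y₀ ∈ C) (hz₁ : z₁ ∈ P ∪ Q) (hz₂ : z₂ ∈ P ∪ Q)
    (hTC₁ : ∀ t, t ∈ T₁ → t ∈ C → t = x₀) (hTC₂ : ∀ t, t ∈ T₂ → t ∈ C → t = y₀)
    (hTS₁ : ∀ t, t ∈ T₁ → t ∈ P ∪ Q → t = z₁) (hTS₂ : ∀ t, t ∈ T₂ → t ∈ P ∪ Q → t = z₂) :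
    G.LinkageMeetsTwice σ e e' C := by
  wlog hz₁P : z₁ ∈ P generalizing P Q a b u v w z
  · exact this (by rw [Sym2.eq_swap, he]) (by rw [Sym2.eq_swap, he']) hvz huw hQ hP
      (fun t h h' => hPQ t h' h) hz₁.symm hz₂.symm (fun t h h' => hTS₁ t h h'.symm)
      (fun t h h' => hTS₂ t h h'.symm) (hz₁.resolve_left hz₁P)
  clear hz₁
  by_cases h2 : ∃ x y, x ∈ C ∧ y ∈ C ∧ x ≠ y ∧ x ∈ P ∪ Q ∧ y ∈ P ∪ Q
  · obtain ⟨x, y, h⟩ := h2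
    exact ⟨u, v, w, z, P, Q, a, b, x, y, he, he', hP, hQ, hPQ, h⟩
  replace h2 : ∀ x y, x ∈ C → y ∈ C → x ∈ P ∪ Q → y ∈ P ∪ Q → x = y := by
    intro x y hx hy hx' hy'
    by_contra hne
    exact h2 ⟨x, y, hx, hy, hne, hx', hy'⟩
  have hx₀T := hT₁.left_mem
  have hz₁T := hT₁.right_mem
  have hy₀T := hT₂.left_mem
  have hz₂T := hT₂.right_mem
  have hxy : x₀ ≠ y₀ := by rintro rfl; exact hTT _ hx₀T hy₀T
  have hzz : z₁ ≠ z₂ := by rintro rfl; exact hTT _ hz₁T hz₂T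
  by_cases hz₂P : z₂ ∈ P
  · obtain ⟨D, t, hD, hDC, hDS⟩ : ∃ D t, G.PathOn σ D t x₀ y₀ ∧ (∀ t, t ∈ D → t ∈ C) ∧
        ∀ t, t ∈ D → t ∈ P ∪ Q → t = z₁ ∨ t = z₂ := by
      obtain ⟨D₁, D₂, t, hD₁, hD₂, hDC, hDD⟩ := hC x₀ y₀ hx₀ hy₀ hxy
      by_cases h : ∀ t, t ∈ D₁ → t ∈ P ∪ Q → t = z₁ ∨ t = z₂
      · exact ⟨D₁, _, hD₁, fun t h => (hDC t).2 (.inl h), h⟩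
      · refine ⟨D₂, _, hD₂, fun t h => (hDC t).2 (.inr h), fun t ht htS => ?_⟩
        push Not at h
        obtain ⟨i, hi, hiS, hi₁, hi₂⟩ := h
        obtain rfl := h2 i t ((hDC _).2 (.inl hi)) ((hDC _).2 (.inr ht)) hiS htS
        rcases hDD i hi ht with rfl | rfl
        · exact .inl (hTS₁ _ hx₀T hiS)
        · exact .inr (hTS₂ _ hy₀T hiS)
    clear hC h2
    have hy₀D := hD.right_mem
    refine .of_ear he he' hP hQ hPQ ((hT₁.symm.append hD ?_).append hT₂ ?_) hz₁P hz₂P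
      hzz ?_ ?_ hx₀ hy₀ hxy (.inl (.inl hx₀T)) (.inl (.inr hy₀D))
    all_goals clear he he'; grind
  have hz₂Q := hz₂.resolve_left hz₂P
  simp only [Set.mem_union, or_imp, forall_and] at hTS₁ hTS₂
  by_cases hs : ∃ s, s ∈ C ∧ s ∈ P ∪ Q ∧ s ≠ z₁ ∧ s ≠ z₂
  · obtain ⟨s, hsC, hsS, hs₁, hs₂⟩ := hs
    have hsT₁ : s ∉ T₁ := by clear hC he he'; grind
    have hsT₂ : s ∉ T₂ := by clear hC he he'; grind
    have h2s : ∀ x, x ∈ C → x ∈ P ∪ Q → x = s := fun x h h' => h2 x s h hsC h' hsS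
    simp only [Set.mem_union, or_imp, forall_and] at h2s
    clear h2
    rcases hsS with hsP | hsQ
    · refine hC.linkageMeetsTwice_of_tails hG he he' huw hvz hP hQ hPQ (PathOn.refl G σ s) hT₂ ?_
        hsC hy₀ hsP hz₂Q ?_ hTC₂ ?_ ?_ hTS₂.2 ?_ ?_ ?_
      all_goals clear hC he he'; grind
    · refine hC.linkageMeetsTwice_of_tails hG he he' huw hvz hP hQ hPQ hT₁ (PathOn.refl G σ s) ?_
        hx₀ hsC hz₁P hsQ hTC₁ ?_ hTS₁.1 ?_ ?_ ?_ ?_ ?_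
      all_goals clear hC he he'; grind
  · push Not at hs
    refine hC.linkageMeetsTwice_of_tails hG he he' huw hvz hP hQ hPQ hT₁ hT₂ hTT
        hx₀ hy₀ hz₁P hz₂Q hTC₁ hTC₂ hTS₁.1 ?_ hTS₂.2 ?_ ?_ ?_
    all_goals clear hC he he' h2; grind

/-- In a 3-connected graph, the linkage of two disjoint edges can be chosen to meet a given cycle
twice. -/
theorem OddCycleOn.linkageMeetsTwice [Finite V] (hG : G.IsVertexConnected 3)
    (hC : G.OddCycleOn σ C) (he : e ∈ G.edgeSet) (he' : e' ∈ G.edgeSet)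
    (hd : ∀ t : V, ¬ (t ∈ e ∧ t ∈ e')) (hx : x ∈ C) (hy : y ∈ C) (hxy : G.Adj x y) :
    G.LinkageMeetsTwice σ e e' C := by
  induction e with | _ c d
  induction e' with | _ c' d'
  obtain ⟨s, u, v, w, z, P, Q, a, b, h₁, h₂, hP, hQ, hPQ, -⟩ := Linkage.exists hG σ he he'
  -- A linkage between an edge of G joining two vertices of C and the edge e contains disjoint tails
  -- from C to P ∪ Q, since the ends of e lie on P and Q.
  obtain ⟨t, x', y', u', v', X, Y, a', b', k₁, k₂, hX, hY, hXY, -⟩ := Linkage.exists hG σ hxy he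
  rw [← h₁] at hd k₂ ⊢
  rw [← h₂] at hd ⊢
  have hxC : x' ∈ C ∧ y' ∈ C := by
    rw [Sym2.eq_iff] at k₁
    rcases k₁ with ⟨rfl, rfl⟩ | ⟨rfl, rfl⟩
    · exact ⟨hx, hy⟩
    · exact ⟨hy, hx⟩
  have huS : u' ∈ P ∪ Q ∧ v' ∈ P ∪ Q := by
    rw [Sym2.eq_iff] at k₂
    rcases k₂ with ⟨rfl, rfl⟩ | ⟨rfl, rfl⟩
    · exact ⟨.inl hP.left_mem, .inr hQ.left_mem⟩
    · exact ⟨.inr hQ.left_mem, .inl hP.left_mem⟩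
  obtain ⟨T₁, t₁, x₀, z₁, hT₁, hTX, hx₀, hz₁, hTC₁, hTS₁⟩ := hX.trim hxC.1 huS.1
  obtain ⟨T₂, t₂, y₀, z₂, hT₂, hTY, hy₀, hz₂, hTC₂, hTS₂⟩ := hY.trim hxC.2 huS.2
  refine hC.linkageMeetsTwice_of_disjoint_tails hG rfl rfl ?_ ?_ hP hQ hPQ hT₁ hT₂
    (fun t h h' => hXY t (hTX t h) (hTY t h')) hx₀ hy₀ hz₁ hz₂ hTC₁ hTC₂ hTS₁ hTS₂
  · rintro rfl
    exact hd u (by simp)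
  · rintro rfl
    exact hd v (by simp)

end SimpleGraph

/-! ### Both parities from an odd cycle -/

namespace SimpleGraph

variable {V : Type*} {G : SimpleGraph V} {σ : Sym2 V → ZMod 2} {e e' : Sym2 V} {C : Set V}
  {x y : V}

theorem OddCycleOn.mono {H : SimpleGraph V} (hle : H ≤ G) (hC : H.OddCycleOn σ C) :
    G.OddCycleOn σ C := fun x y hx hy hxy => by
  obtain ⟨D₁, D₂, t, h₁, h₂, h⟩ := hC x y hx hy hxy
  exact ⟨D₁, D₂, t, h₁.mono hle, h₂.mono hle, h⟩

/-- In a 3-connected graph, two disjoint edges whose deletion leaves an odd cycle have linkages of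
both parities. -/
theorem OddCycleOn.bothParities [Finite V] (hG : G.IsVertexConnected 3)
    (hC : (G.deleteEdges {e, e'}).OddCycleOn σ C) (he : e ∈ G.edgeSet) (he' : e' ∈ G.edgeSet)
    (hd : ∀ t : V, ¬ (t ∈ e ∧ t ∈ e')) (hx : x ∈ C) (hy : y ∈ C) (hxy : G.Adj x y) :
    G.BothParities σ e e' := by
  obtain ⟨u, v, w, z, P, Q, a, b, x', y', h₁, h₂, hP, hQ, hPQ, hx', hy', hne, hxS, hyS⟩ :=
    (hC.mono (SimpleGraph.deleteEdges_le _)).linkageMeetsTwice hG he he' hd hx hy hxy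
  refine hC.bothParities_of_linkage hG h₁ h₂ ?_ ?_ hP hQ hPQ hx' hy' hne hxS hyS
  · rintro rfl
    exact hd u (by simp [← h₁, ← h₂])
  · rintro rfl
    exact hd v (by simp [← h₁, ← h₂])

end SimpleGraph

/-! ### Translation between signs and parities -/

namespace SimpleSignedGraph

variable {V : Type*}

/-- The sign `(-1) ^ a`. -/
def signOfParity (a : ZMod 2) : ℤˣ := if a = 0 then 1 else -1

theorem signOfParity_add (a b : ZMod 2) :
    signOfParity (a + b) = signOfParity a * signOfParity b := by
  revert a b; decide

theorem exists_signOfParity_eq (s : ℤˣ) : ∃ a, signOfParity a = s := by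
  rcases Int.units_eq_one_or s with rfl | rfl
  · exact ⟨0, rfl⟩
  · exact ⟨1, rfl⟩

theorem eq_one_of_signOfParity_eq {a : ZMod 2} (h : signOfParity a = -1) : a = 1 := by
  revert a; decide

theorem signOfParity_sum (l : List (ZMod 2)) :
    signOfParity l.sum = (l.map signOfParity).prod := by
  induction l with
  | nil => rfl
  | cons a l ih => simp [signOfParity_add, ih]

open Classical in
/-- The parity of an edge: `1` for the negative edges, `0` for all others. -/
noncomputable def parity (G : SimpleSignedGraph V) (e : Sym2 V) : ZMod 2 :=
  if ∃ h : e ∈ G.graph.edgeSet, G.sign ⟨e, h⟩ = -1 then 1 else 0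

theorem signOfParity_parity (G : SimpleSignedGraph V) {e : Sym2 V} (he : e ∈ G.graph.edgeSet) :
    signOfParity (G.parity e) = G.sign ⟨e, he⟩ := by
  rcases Int.units_eq_one_or (G.sign ⟨e, he⟩) with h | h
  · simp [parity, he, h, signOfParity]
  · simp [parity, he, h, signOfParity]

theorem walkSign_eq (G : SimpleSignedGraph V) {u v : V} (p : G.graph.Walk u v) :
    G.walkSign p = signOfParity (p.edges.map G.parity).sum := by
  rw [walkSign, signOfParity_sum, List.map_map]
  refine congrArg List.prod (.trans ?_ (List.attach_map_val (f := signOfParity ∘ G.parity)))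
  exact List.map_congr_left fun e _ => (G.signOfParity_parity _).symm

end SimpleSignedGraph

theorem lemma3p2 {V : Type*} [Finite V] (G : SimpleSignedGraph V)
    (hG : G.graph.IsVertexConnected 3)
    (e₁ e₂ : Sym2 V) (he₁ : e₁ ∈ G.graph.edgeSet) (he₂ : e₂ ∈ G.graph.edgeSet)
    (hnonadj : ∀ v : V, ¬ (v ∈ e₁ ∧ v ∈ e₂))
    (hneg : (G.deleteEdges {e₁, e₂}).Unbalanced) :
    G.Untied e₁ e₂ := by
  obtain ⟨v, C, hC, hs⟩ := hneg
  rw [SimpleSignedGraph.walkSign_eq] at hs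
  have hσ : ∀ e ∈ C.edges, (G.deleteEdges {e₁, e₂}).parity e = G.parity e := fun e he => by
    have h := C.edges_subset_edgeSet he
    have h' : e ∈ G.graph.edgeSet := SimpleGraph.edgeSet_mono (SimpleGraph.deleteEdges_le _) h
    simp only [SimpleSignedGraph.parity, h, h', exists_true_left]
    rfl
  rw [List.map_congr_left hσ] at hs
  have hodd := hC.oddCycleOn (σ := G.parity) (SimpleSignedGraph.eq_one_of_signOfParity_eq hs)
  have hadj : G.graph.Adj v C.snd :=
    SimpleGraph.deleteEdges_le (G := G.graph) {e₁, e₂} (C.adj_snd hC.not_nil)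
  have hB := SimpleGraph.OddCycleOn.bothParities hG hodd he₁ he₂ hnonadj C.start_mem_support
    (C.snd_mem_support_of_mem_edges (C.mk_start_snd_mem_edges hC.not_nil)) hadj
  have hne : e₁ ≠ e₂ := by
    rintro rfl
    induction e₁ with | _ a b
    exact hnonadj a (by simp)
  intro s
  obtain ⟨a, rfl⟩ := SimpleSignedGraph.exists_signOfParity_eq s
  -- The labels of `e₁` and `e₂` are added in advance, so that they cancel when the linkage is
  -- closed up through these edges.
  obtain ⟨w, D, hD, h₁, h₂, h⟩ :=
    (hB (a + G.parity e₁ + G.parity e₂)).exists_isCycle he₁ he₂ hne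
  refine ⟨w, D, hD, h₁, h₂, ?_⟩
  rw [SimpleSignedGraph.walkSign_eq, h]
  congr 1
  grind
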